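/- Let $K$ be a number field with algebraic closure $\overline{K}$, let $a,b,c\in K[t]$ with $b$ and $c$ nonconstant, and let $$\phi_t(x)=\frac{x^2+b(t)x}{c(t)x+1}.$$ For a positive integer $N$ let $Y^{\mathrm{pre}}(N)\subset\mathbb{A}^2$ be the algebraic set, in the coordinates $(x,t)$, defined by the equation obtained from $\phi_t^N(x)-a(t)=0$ by clearing denominators (here $\phi_t^N$ is the $N$-th iterate in $x$), and let $Y^{\mathrm{pre}}(N,1),\dots,Y^{\mathrm{pre}}(N,r_N)$ be its irreducible components over $\overline{K}$. Let $\deg_x Y^{\mathrm{pre}}(N,i)$ be the degree in $x$ of the irreducible polynomial defining $Y^{\mathrm{pre}}(N,i)$. The points at infinity of $Y^{\mathrm{pre}}(N,i)$ are the $\overline{K}$-points of the nonsingular completion of its normalization that do not lie on the normalization; the set of points at infinity of $Y^{\mathrm{pre}}(N)$ is the disjoint union over $i$ of the sets of points at infinity of the $Y^{\mathrm{pre}}(N,i)$. For a field $K\subset L\subset\overline{K}$, a point at infinity is called $L$-rational if it is fixed by $\mathrm{Gal}(\overline{K}/L)$. Let $N$ be a positive integer and $i\in\{1,\dots,r_N\}$.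 (1) There exists a quadratic extension $K'$ of $K$ in $\overline{K}$ such that $Y^{\mathrm{pre}}(N,i)$ is defined over $K'$ and has at least $\frac12\deg_x Y^{\mathrm{pre}}(N,i)$ $K'$-rational points at infinity and, except when $N\ge 2$, $a=-1$ and $b+c=2$, such that moreover $Y^{\mathrm{pre}}(N)$ has at least $2^{N-1}$ $K'$-rational points at infinity. (2) If $\deg a+\deg c\neq\deg b$ (with $\deg 0=-\infty$), then $Y^{\mathrm{pre}}(N,i)$ is defined over $K$ and has exactly $\deg_x Y^{\mathrm{pre}}(N,i)$ $K$-rational points at infinity, and $Y^{\mathrm{pre}}(N)$ has exactly $2^N$ $K$-rational points at infinity. -/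

import Mathlib

open Polynomial

noncomputable section

namespace PreimageCurve

/-! Elements of `k[X][X]` are polynomials in `x` (the outer variable) with coefficients in `k[t]`
(`t` is the inner variable). -/

section Equation

variable {k : Type*} [Field k]

/-- The pair `(Pₙ, Qₙ)` of polynomials in `x` and `t` with `φ_t^n(x) = Pₙ / Qₙ`, obtained by clearing
denominators in the iterates of `φ_t(x) = (x² + b(t) x) / (c(t) x + 1)`. -/
def iterNumDen (b c : k[X]) : ℕ → k[X][X] × k[X][X]
  | 0 => (X, 1)
  | n + 1 =>
    let p := (iterNumDen b c n).1
    let q := (iterNumDen b c n).2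
    (p ^ 2 + C b * p * q, C c * p * q + q ^ 2)

/-- The polynomial in `x` and `t` whose vanishing is the equation `φ_t^N(x) - a(t) = 0` after
clearing denominators. -/
def preimagePoly (a b c : k[X]) (N : ℕ) : k[X][X] :=
  (iterNumDen b c N).1 - C a * (iterNumDen b c N).2

theorem iterNumDen_coeff_zero (b c : k[X]) (n : ℕ) :
    (iterNumDen b c n).1.coeff 0 = 0 ∧ (iterNumDen b c n).2.coeff 0 = 1 := by
  induction n with
  | zero => simp [iterNumDen]
  | succ n ih =>
    obtain ⟨h1, h2⟩ := ih
    simp [iterNumDen, pow_two, mul_coeff_zero, h1, h2]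

/-- In the field of rational functions in `x` and `t`, the fraction `Pₙ / Qₙ` really is the `n`-th
iterate of `φ_t` at `x`. -/
theorem iterNumDen_spec (b c : k[X]) (n : ℕ) :
    (fun z : FractionRing k[X][X] =>
        (z ^ 2 + algebraMap k[X][X] _ (C b) * z) / (algebraMap k[X][X] _ (C c) * z + 1))^[n]
      (algebraMap k[X][X] _ X) =
    algebraMap k[X][X] _ (iterNumDen b c n).1 / algebraMap k[X][X] _ (iterNumDen b c n).2 := by
  have hne : ∀ m, algebraMap k[X][X] (FractionRing k[X][X]) (iterNumDen b c m).2 ≠ 0 := by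
    intro m h
    rw [FaithfulSMul.algebraMap_eq_zero_iff] at h
    have := (iterNumDen_coeff_zero b c m).2
    simp [h] at this
  induction n with
  | zero => simp [iterNumDen]
  | succ n ih =>
    rw [Function.iterate_succ_apply', ih]
    have h1 := hne n
    have h2 := hne (n + 1)
    simp only [iterNumDen, map_add, map_mul, map_pow] at h2 ⊢
    set p := algebraMap k[X][X] (FractionRing k[X][X]) (iterNumDen b c n).1
    set q := algebraMap k[X][X] (FractionRing k[X][X]) (iterNumDen b c n).2
    set B := algebraMap k[X][X] (FractionRing k[X][X]) (C b)
    set D := algebraMap k[X][X] (FractionRing k[X][X]) (C c)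
    have h3 : D * (p / q) + 1 = (D * p * q + q ^ 2) / q ^ 2 := by field_simp
    have h4 : (p / q) ^ 2 + B * (p / q) = (p ^ 2 + B * p * q) / q ^ 2 := by field_simp
    rw [h3, h4, div_div_div_cancel_right₀ (pow_ne_zero 2 h1)]

end Equation

variable {K : Type*} [Field K]

/-- The irreducible components over the algebraic closure of `K` of the algebraic set
`Y(N) : φ_t^N(x) = a(t)` in the affine plane. A component is given by its prime ideal: the prime
ideals of `K̄[t][x]` minimal over the ideal generated by the equation of `Y(N)`. -/
def Component (a b c : K[X]) (N : ℕ) : Type _ :=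
  {I : Ideal (AlgebraicClosure K)[X][X] //
    I ∈ (Ideal.span {(preimagePoly a b c N).map
      (mapRingHom (algebraMap K (AlgebraicClosure K)))}).minimalPrimes}

/-- Action on `K̄[t][x]`, coefficient by coefficient, of an automorphism of `K̄` over `L`. -/
def conj {L : Type*} [Field L] [Algebra L (AlgebraicClosure K)]
    (σ : AlgebraicClosure K ≃ₐ[L] AlgebraicClosure K) :
    (AlgebraicClosure K)[X][X] →+* (AlgebraicClosure K)[X][X] :=
  mapRingHom (mapRingHom (σ : AlgebraicClosure K →+* AlgebraicClosure K))

namespace Component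

variable {a b c : K[X]} {N : ℕ}

/-- The ideal of polynomials vanishing on the component. -/
def ideal (Y : Component a b c N) : Ideal (AlgebraicClosure K)[X][X] := Y.1

instance (Y : Component a b c N) : Y.ideal.IsPrime := Y.2.1.1

instance (Y : Component a b c N) : Y.ideal.IsPrincipal := by
  obtain ⟨I, hI⟩ := Y
  change I.IsPrincipal
  set F := (preimagePoly a b c N).map (mapRingHom (algebraMap K (AlgebraicClosure K)))
  have hp : I.IsPrime := hI.1.1
  have hF : F ∈ I := hI.1.2 (Ideal.mem_span_singleton_self F)
  by_cases h0 : F = 0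
  · have : I ≤ ⊥ := hI.2 ⟨Ideal.isPrime_bot, by simp [h0]⟩ bot_le
    rw [le_bot_iff.mp this]
    infer_instance
  · obtain ⟨s, hs, u, hu⟩ := WfDvdMonoid.exists_factors F h0
    have hsI : s.prod ∈ I := by
      rw [← hu] at hF
      exact (hp.mem_or_mem hF).resolve_right
        fun h => hp.ne_top (Ideal.eq_top_of_isUnit_mem _ h u.isUnit)
    obtain ⟨f, hfs, hfI⟩ := hp.multiset_prod_mem_iff_exists_mem s |>.mp hsI
    have hle : Ideal.span {f} ≤ I := by simpa [Ideal.span_le] using hfI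
    have hprime : (Ideal.span {f}).IsPrime :=
      (Ideal.span_singleton_prime (hs f hfs).ne_zero).mpr (hs f hfs).prime
    have hFf : f ∣ F := (Multiset.dvd_prod hfs).trans ⟨u, hu.symm⟩
    have : I ≤ Ideal.span {f} :=
      hI.2 ⟨hprime, by rwa [Ideal.span_singleton_le_span_singleton]⟩ hle
    rw [le_antisymm this hle]
    infer_instance

/-- The degree in `x` of the equation defining the component in the affine plane. -/
def degX (Y : Component a b c N) : ℕ :=
  (Submodule.IsPrincipal.generator Y.ideal).natDegree

/-- The component is defined over `L`: its ideal is generated by polynomials with coefficients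
in `L`. -/
def IsDefinedOver (Y : Component a b c N) (L : Type*) [Field L] [Algebra L (AlgebraicClosure K)] :
    Prop :=
  ∃ J : Ideal L[X][X],
    Y.ideal = J.map (mapRingHom (mapRingHom (algebraMap L (AlgebraicClosure K))))

/-- The coordinate ring, over `K̄`, of the component. -/
def CoordinateRing (Y : Component a b c N) : Type _ := (AlgebraicClosure K)[X][X] ⧸ Y.ideal

instance (Y : Component a b c N) : CommRing Y.CoordinateRing :=
  inferInstanceAs (CommRing ((AlgebraicClosure K)[X][X] ⧸ Y.ideal))

instance (Y : Component a b c N) : IsDomain Y.CoordinateRing :=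
  inferInstanceAs (IsDomain ((AlgebraicClosure K)[X][X] ⧸ Y.ideal))

/-- Restriction of polynomials in `x` and `t` to the component. -/
def toCoordinateRing (Y : Component a b c N) :
    (AlgebraicClosure K)[X][X] →+* Y.CoordinateRing :=
  Ideal.Quotient.mk Y.ideal

/-- The function field, over `K̄`, of the component. -/
abbrev FunctionField (Y : Component a b c N) : Type _ := FractionRing Y.CoordinateRing

/-- The element of the function field defined by a polynomial in `x` and `t`. -/
def toFunctionField (Y : Component a b c N) :
    (AlgebraicClosure K)[X][X] →+* Y.FunctionField :=
  (algebraMap Y.CoordinateRing Y.FunctionField).comp Y.toCoordinateRing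

/-- The `K̄`-points of the nonsingular complete curve with the function field of the component
(the completion of its normalization), each given by its local ring: the valuation rings of the
function field that contain `K̄`, other than the function field itself. -/
def completeCurve (Y : Component a b c N) : Set (ValuationSubring Y.FunctionField) :=
  {A | (∀ z : AlgebraicClosure K, Y.toFunctionField (C (C z)) ∈ A) ∧ A ≠ ⊤}

/-- The points of the complete curve that lie on the (affine) normalization of the component: the
local ring contains the integral closure of the coordinate ring. -/
def normalization (Y : Component a b c N) : Set (ValuationSubring Y.FunctionField) :=
  {A | A ∈ Y.completeCurve ∧ ∀ z : Y.FunctionField, IsIntegral Y.CoordinateRing z → z ∈ A}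

/-- The set of points at infinity of the component. -/
def pointsAtInfinity (Y : Component a b c N) : Set (ValuationSubring Y.FunctionField) :=
  Y.completeCurve \ Y.normalization

/-- A point of the complete curve is `L`-rational: every automorphism of `K̄` over `L` maps the
component to itself and the point to itself. (The automorphism sends the rational function `g / h`
to the rational function with conjugate coefficients.) -/
def IsRational (Y : Component a b c N) (L : Type*) [Field L] [Algebra L (AlgebraicClosure K)]
    (A : ValuationSubring Y.FunctionField) : Prop :=
  ∀ σ : AlgebraicClosure K ≃ₐ[L] AlgebraicClosure K,
    Y.ideal.map (conj σ) = Y.ideal ∧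
    ∀ g h : (AlgebraicClosure K)[X][X], h ∉ Y.ideal →
      (Y.toFunctionField g / Y.toFunctionField h ∈ A ↔
        Y.toFunctionField (conj σ g) / Y.toFunctionField (conj σ h) ∈ A)

/-- The set of `L`-rational points at infinity of the component. -/
def rationalPointsAtInfinity (Y : Component a b c N) (L : Type*) [Field L]
    [Algebra L (AlgebraicClosure K)] : Set (ValuationSubring Y.FunctionField) :=
  {A | A ∈ Y.pointsAtInfinity ∧ Y.IsRational L A}

end Component

/-- The set of `L`-rational points at infinity of `Y(N)`, the disjoint union over the irreducible
components of `Y(N)` over `K̄` of their sets of `L`-rational points at infinity. -/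
def rationalPointsAtInfinity (a b c : K[X]) (N : ℕ) (L : Type*) [Field L]
    [Algebra L (AlgebraicClosure K)] :
    Set (Σ Y : Component a b c N, ValuationSubring Y.FunctionField) :=
  {p | p.2 ∈ p.1.rationalPointsAtInfinity L}

end PreimageCurve

end

/-!
Near `t = ∞` the curve `Y(N)` is described by the roots of its equation in Laurent series. Put
`t = s⁻²` and let `E = K̄((s))`, with the valuation `v` that makes `b` and `c` larger than `1`. The
Galois group of `K̄` acts on `E` through the coefficients, and `s ↦ -s` acts as well; these
automorphisms preserve `v`.

The solutions of `φ(x) = y` are the roots `x₁, x₂` of `x² + e x - y` with `e = b - y c`, and the fibre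
polynomial of `φⁿ⁺¹` over `y` is the product of those of `φⁿ` over `x₁` and over `x₂`
(`fiberPoly_succ`). If `v (y c) ≠ v b`, then `v e ^ 2 > v y`: the two roots lie in the field, are
distinguished by their valuations, hence fixed by every isometry fixing `b`, `c` and `y`, and satisfy
`v (xᵢ c) ≠ v b` again. So the fibre polynomial splits into distinct factors rational over the
data (`splitsOver_of_ne`). This is the case `deg a + deg c ≠ deg b`.

If `v (y c) = v b` and `v y > 1`, either the roots still have different valuations, and
only the larger one can be in the bad case again, or both have valuation `√(v y)` and fall
under the first case; the latter happens at most once and is the only place where a square root `w` of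
a discriminant is adjoined (`quadraticRoots_of_one_lt`). The discriminant is a series in `t⁻¹` over
`K`, so `w` exists in `E`, and it is fixed by the automorphisms over any field that contains
its leading coefficient, whose square is in `K` (`fixedBy_of_sq`). If the discriminant vanishes,
the fibre polynomial is a square, but no extension is needed. If `v y = 1` and `e` is integral, then
`a` and `e` are constants and so are `x₁`, `x₂`; everything works unless `x₁ = x₂ = -1`, which means
`a = -1`, `b + c = 2` (`quadraticRoots_of_eq_one`).

A root `ρ` of the equation of a component defines an embedding of the function field in `E`, hence a
point at infinity (`IsGenericRoot.exists_represents`), rational over `L` if `ρ` is fixed by the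
automorphisms over `L`. Two roots give the same point only if they are equal or exchanged by
`s ↦ -s` (`Represents.eq_or_eq_flip`); this loses at most a factor `2`, and nothing if the roots are
series in `t⁻¹`. Conversely a component has at most `degX` points at infinity, by the identity
`∑ e f = n` for the primes above `t = ∞` (`Component.finite_pointsAtInfinity_and_ncard_le`).
-/

open Polynomial

noncomputable section

namespace PreimageCurve

/-! ### Iterates over a field and fibre polynomials -/

section RootTree

variable {E : Type*} [Field E]

/-- The pair `(Pₙ, Qₙ)` with `φⁿ(x) = Pₙ / Qₙ` for `φ(x) = (x² + b x) / (c x + 1)` over a field `E`: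
the analogue of `iterNumDen` when `b` and `c` are elements of `E`. -/
def iterPair (b c : E) : ℕ → E[X] × E[X]
  | 0 => (X, 1)
  | n + 1 =>
    let p := (iterPair b c n).1
    let q := (iterPair b c n).2
    (p ^ 2 + C b * p * q, C c * p * q + q ^ 2)

/-- The fibre polynomial `Pₙ - y Qₙ`, whose roots are the solutions of `φⁿ(x) = y`. -/
def fiberPoly (b c : E) (n : ℕ) (y : E) : E[X] :=
  (iterPair b c n).1 - C y * (iterPair b c n).2

theorem iterPair_degree (b c : E) (n : ℕ) :
    (iterPair b c n).1.Monic ∧ (iterPair b c n).1.natDegree = 2 ^ n ∧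
      (iterPair b c n).2.degree < (2 ^ n : ℕ) := by
  induction n with
  | zero => simp [iterPair, monic_X]
  | succ n ih =>
    obtain ⟨hm, hd, hq⟩ := ih
    simp only [iterPair]
    set p := (iterPair b c n).1
    set q := (iterPair b c n).2
    have hp : p.degree = (2 ^ n : ℕ) := by rw [degree_eq_natDegree hm.ne_zero, hd]
    have hC : ∀ z : E, (C z * p * q).degree < (2 ^ (n + 1) : ℕ) := by
      intro z
      have h1 : (C z * p).degree ≤ (2 ^ n : ℕ) := by
        calc (C z * p).degree ≤ (C z).degree + p.degree := degree_mul_le _ _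
          _ ≤ 0 + p.degree := by gcongr; exact degree_C_le
          _ = _ := by rw [zero_add, hp]
      by_cases hq0 : q = 0
      · simp only [hq0, mul_zero, degree_zero]; exact WithBot.bot_lt_coe _
      · have h2 : q.natDegree < 2 ^ n := (natDegree_lt_iff_degree_lt hq0).2 hq
        have h3 := natDegree_le_of_degree_le h1
        refine lt_of_le_of_lt degree_le_natDegree ?_
        have := natDegree_mul_le (p := C z * p) (q := q)
        rw [pow_succ]
        exact_mod_cast (by omega)
    have hp2 : (p ^ 2).degree = (2 ^ (n + 1) : ℕ) := by
      rw [degree_pow, hp, pow_succ]; simp [mul_comm]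
    have hlt : (C b * p * q).degree < (p ^ 2).degree := by rw [hp2]; exact hC b
    refine ⟨(hm.pow 2).add_of_left hlt, ?_, ?_⟩
    · apply natDegree_eq_of_degree_eq_some
      rw [degree_add_eq_left_of_degree_lt hlt, hp2]
    · refine lt_of_le_of_lt (degree_add_le _ _) (max_lt (hC c) ?_)
      by_cases hq0 : q = 0
      · simp only [hq0, ne_eq, OfNat.ofNat_ne_zero, not_false_eq_true, zero_pow, degree_zero]
        exact WithBot.bot_lt_coe _
      have h2 : q.natDegree < 2 ^ n := (natDegree_lt_iff_degree_lt hq0).2 hq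
      refine lt_of_le_of_lt degree_le_natDegree ?_
      rw [natDegree_pow, pow_succ]
      exact_mod_cast (by omega)

theorem fiberPoly_monic (b c : E) (n : ℕ) (y : E) : (fiberPoly b c n y).Monic := by
  obtain ⟨hm, hd, hq⟩ := iterPair_degree b c n
  apply hm.sub_of_left
  rw [degree_eq_natDegree hm.ne_zero, hd]
  by_cases hy : y = 0
  · simp only [hy, map_zero, zero_mul, degree_zero]; exact WithBot.bot_lt_coe _
  · rwa [degree_C_mul hy]

theorem fiberPoly_natDegree (b c : E) (n : ℕ) (y : E) :
    (fiberPoly b c n y).natDegree = 2 ^ n := by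
  obtain ⟨hm, hd, hq⟩ := iterPair_degree b c n
  apply natDegree_eq_of_degree_eq_some
  rw [fiberPoly, degree_sub_eq_left_of_degree_lt] <;> rw [degree_eq_natDegree hm.ne_zero, hd]
  by_cases hy : y = 0
  · simp only [hy, map_zero, zero_mul, degree_zero]; exact WithBot.bot_lt_coe _
  · rwa [degree_C_mul hy]

theorem fiberPoly_zero (b c y : E) : fiberPoly b c 0 y = X - C y := by
  simp [fiberPoly, iterPair]

/-- If `x₁`, `x₂` are the solutions of `φ(x) = y`, the solutions of `φⁿ⁺¹(x) = y` are those of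
`φⁿ(x) = x₁` and of `φⁿ(x) = x₂`. -/
theorem fiberPoly_succ {b c y x₁ x₂ : E} (n : ℕ) (hs : x₁ + x₂ = y * c - b)
    (hp : x₁ * x₂ = -y) :
    fiberPoly b c (n + 1) y = fiberPoly b c n x₁ * fiberPoly b c n x₂ := by
  simp only [fiberPoly, iterPair]
  have h1 : (C x₁ + C x₂ : E[X]) = C y * C c - C b := by rw [← C_add, hs]; simp
  have h2 : (C x₁ * C x₂ : E[X]) = -C y := by rw [← C_mul, hp]; simp
  linear_combination ((iterPair b c n).1 * (iterPair b c n).2) * h1 -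
    ((iterPair b c n).2 ^ 2) * h2

/-- If `b c = 1`, then `φ` is constant; otherwise numerator and denominator stay coprime. -/
theorem isCoprime_iterPair {b c : E} (h : b * c ≠ 1) (n : ℕ) :
    IsCoprime (iterPair b c n).1 (iterPair b c n).2 := by
  induction n with
  | zero => exact isCoprime_one_right
  | succ n ih =>
    simp only [iterPair]
    set p := (iterPair b c n).1
    set q := (iterPair b c n).2
    have hpq : IsCoprime (p + C b * q) (C c * p + q) := by
      have hu : (1 - b * c) ≠ 0 := sub_ne_zero.2 (Ne.symm h)
      obtain ⟨u, w, huw⟩ := ih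
      have hi : (C (1 - b * c)⁻¹ : E[X]) * (1 - C b * C c) = 1 := by
        rw [← C_mul, ← C_1, ← C_sub, ← C_mul, inv_mul_cancel₀ hu]
      refine ⟨C (1 - b * c)⁻¹ * (u - C c * w), C (1 - b * c)⁻¹ * (w - C b * u), ?_⟩
      linear_combination hi * (u * p + w * q) + huw
    have e1 : p ^ 2 + C b * p * q = p * (p + C b * q) := by ring
    have e2 : C c * p * q + q ^ 2 = q * (C c * p + q) := by ring
    rw [e1, e2]
    refine IsCoprime.mul_left (IsCoprime.mul_right ih ?_) (IsCoprime.mul_right ?_ hpq)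
    · simpa [mul_comm, add_comm] using (IsCoprime.add_mul_left_right ih (C c))
    · simpa [mul_comm] using (IsCoprime.add_mul_right_left ih (C b))

theorem isCoprime_fiberPoly {b c : E} (h : b * c ≠ 1) (n : ℕ) {y₁ y₂ : E} (hy : y₁ ≠ y₂) :
    IsCoprime (fiberPoly b c n y₁) (fiberPoly b c n y₂) := by
  obtain ⟨u, w, huw⟩ := isCoprime_iterPair h n
  have hi : (C (y₁ - y₂)⁻¹ : E[X]) * (C y₁ - C y₂) = 1 := by
    rw [← C_sub, ← C_mul, inv_mul_cancel₀ (sub_ne_zero.2 hy), C_1]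
  refine ⟨C (y₁ - y₂)⁻¹ * (-C y₂ * u - w), C (y₁ - y₂)⁻¹ * (C y₁ * u + w), ?_⟩
  simp only [fiberPoly]
  linear_combination hi * (u * (iterPair b c n).1 + w * (iterPair b c n).2) + huw

variable {Γ₀ : Type*} [LinearOrderedCommGroupWithZero Γ₀] (v : Valuation E Γ₀)

/-- The elements fixed by every endomorphism of the valued field that fixes `S` pointwise and
preserves the valuation. -/
def rationalClosure (S : Set E) : Subfield E where
  carrier := {z | ∀ σ : E →+* E, (∀ w, v (σ w) = v w) → (∀ s ∈ S, σ s = s) → σ z = z}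
  mul_mem' ha hb σ h1 h2 := by rw [map_mul, ha σ h1 h2, hb σ h1 h2]
  one_mem' σ _ _ := map_one σ
  add_mem' ha hb σ h1 h2 := by rw [map_add, ha σ h1 h2, hb σ h1 h2]
  zero_mem' σ _ _ := map_zero σ
  neg_mem' ha σ h1 h2 := by rw [map_neg, ha σ h1 h2]
  inv_mem' a ha σ h1 h2 := by rw [map_inv₀, ha σ h1 h2]

variable {v}

theorem subset_rationalClosure {S : Set E} {z : E} (h : z ∈ S) : z ∈ rationalClosure v S :=
  fun _ _ h2 => h2 z h

theorem rationalClosure_le {S T : Set E} (h : ∀ s ∈ S, s ∈ rationalClosure v T) :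
    rationalClosure v S ≤ rationalClosure v T :=
  fun _ hz σ h1 h2 => hz σ h1 fun s hs => h s hs σ h1 h2

theorem rationalClosure_le_of_mem {S : Set E} {b c x : E} (hb : b ∈ rationalClosure v S)
    (hc : c ∈ rationalClosure v S) (hx : x ∈ rationalClosure v S) :
    rationalClosure v {b, c, x} ≤ rationalClosure v S :=
  rationalClosure_le (by simp [hb, hc, hx])

variable (v)

/-- The polynomial splits into distinct linear factors whose roots are fixed by every isometric
endomorphism fixing `S` pointwise. -/
structure SplitsOver (S : Set E) (p : E[X]) : Prop where
  splits : p.Splits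
  nodup : p.roots.Nodup
  mem : ∀ r ∈ p.roots, r ∈ rationalClosure v S

variable {v}

theorem SplitsOver.mono {S T : Set E} {p : E[X]} (hp : SplitsOver v S p)
    (h : rationalClosure v S ≤ rationalClosure v T) : SplitsOver v T p :=
  ⟨hp.splits, hp.nodup, fun r hr => h (hp.mem r hr)⟩

theorem SplitsOver.mul {S : Set E} {p q : E[X]} (hp : SplitsOver v S p) (hq : SplitsOver v S q)
    (h0 : p * q ≠ 0) (hpq : IsCoprime p q) : SplitsOver v S (p * q) where
  splits := hp.splits.mul hq.splits
  nodup := by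
    rw [roots_mul h0, Multiset.nodup_add]
    refine ⟨hp.nodup, hq.nodup, Multiset.disjoint_left.2 fun {r} h1 h2 => ?_⟩
    obtain ⟨u, w, huw⟩ := hpq
    have := congrArg (eval r) huw
    simp [(mem_roots'.1 h1).2.eq_zero, (mem_roots'.1 h2).2.eq_zero] at this
  mem r hr := by
    rw [roots_mul h0, Multiset.mem_add] at hr
    exact hr.elim (hp.mem r) (hq.mem r)

theorem SplitsOver.X_sub_C {S : Set E} {y : E} (hy : y ∈ rationalClosure v S) :
    SplitsOver v S (X - C y) where
  splits := Splits.X_sub_C y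
  nodup := by simp
  mem r hr := by
    rw [roots_X_sub_C, Multiset.mem_singleton] at hr
    rwa [hr]

theorem SplitsOver.fiberPoly_succ {S : Set E} {b c y x₁ x₂ : E} {n : ℕ} (h : b * c ≠ 1)
    (hs : x₁ + x₂ = y * c - b) (hp : x₁ * x₂ = -y) (hne : x₁ ≠ x₂)
    (h₁ : SplitsOver v S (fiberPoly b c n x₁)) (h₂ : SplitsOver v S (fiberPoly b c n x₂)) :
    SplitsOver v S (fiberPoly b c (n + 1) y) := by
  rw [PreimageCurve.fiberPoly_succ n hs hp]
  exact h₁.mul h₂ (mul_ne_zero (fiberPoly_monic ..).ne_zero (fiberPoly_monic ..).ne_zero)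
    (isCoprime_fiberPoly h n hne)

theorem SplitsOver.card_roots {S : Set E} {b c y : E} {n : ℕ}
    (h : SplitsOver v S (fiberPoly b c n y)) [DecidableEq E] :
    (fiberPoly b c n y).roots.toFinset.card = 2 ^ n := by
  rw [Multiset.toFinset_card_of_nodup h.nodup, ← h.splits.natDegree_eq_card_roots,
    fiberPoly_natDegree]

end RootTree

/-! ### Splitting of the fibre polynomials over a valued field -/

section RootTree

variable {E : Type*} [Field E] {Γ₀ : Type*} [LinearOrderedCommGroupWithZero Γ₀]
  {v : Valuation E Γ₀}

/-- When `v y < v e ^ 2`, the roots of `x² + e x - y` lie in the field and have different valuations,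
so that every isometry fixing `e` and `y` fixes each of them. -/
theorem exists_roots_of_lt (h2 : v 2 = 1) (hsq : ∀ D w, v D = v w ^ 2 → IsSquare D) {e y : E}
    (h : v y < v e ^ 2) : ∃ x₁ x₂, x₁ + x₂ = -e ∧ x₁ * x₂ = -y ∧ v x₁ = v e ∧
      v x₂ * v e = v y ∧ v x₂ < v x₁ ∧ x₁ ∈ rationalClosure v {e, y} ∧
      x₂ ∈ rationalClosure v {e, y} := by
  have h20 : (2 : E) ≠ 0 := fun h0 => by simp [h0] at h2
  have hv4 : v (4 * y) = v y := by
    rw [show (4 : E) = 2 * 2 by norm_num, map_mul, map_mul, h2, one_mul, one_mul]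
  have he0 : v e ≠ 0 := fun h0 => by simp [h0] at h
  have hD : v (e ^ 2 + 4 * y) = v e ^ 2 := by
    rw [Valuation.map_add_eq_of_lt_left, map_pow]
    rwa [map_pow, hv4]
  obtain ⟨w₀, hw₀⟩ := hsq _ _ hD
  -- of the two square roots of the discriminant, take the one which does not cancel `e`
  have key : ∃ w, e ^ 2 + 4 * y = w * w ∧ v (e + w) = v e := by
    have hvw : v w₀ = v e := by
      have : v w₀ ^ 2 = v e ^ 2 := by rw [← hD, hw₀, map_mul, sq]
      exact (pow_left_inj₀ zero_le zero_le two_ne_zero).1 this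
    by_cases h1 : v (e + w₀) = v e
    · exact ⟨w₀, hw₀, h1⟩
    · refine ⟨-w₀, by rw [hw₀]; ring, ?_⟩
      have hle : v (e + w₀) ≤ v e := (v.map_add _ _).trans (by simp [hvw])
      have hlt : v (e + w₀) < v (2 * e) := by
        rw [map_mul, h2, one_mul]; exact lt_of_le_of_ne hle h1
      have := Valuation.map_sub_eq_of_lt_left v hlt
      rw [map_mul, h2, one_mul] at this
      rw [← this]; congr 1; ring
  obtain ⟨w, hw, hew⟩ := key
  set x₁ := -(e + w) / 2 with hx₁
  have hvx₁ : v x₁ = v e := by rw [hx₁, map_div₀, Valuation.map_neg, h2, div_one, hew]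
  set x₂ := -e - x₁ with hx₂
  have hsum : x₁ + x₂ = -e := by rw [hx₂]; ring
  have hprod : x₁ * x₂ = -y := by
    rw [hx₂, hx₁]; field_simp; linear_combination hw
  have hvx₂ : v x₂ * v e = v y := by
    rw [← hvx₁, ← map_mul, mul_comm, hprod, Valuation.map_neg]
  have hlt : v x₂ < v x₁ := by
    rw [hvx₁]
    by_contra hcon
    push Not at hcon
    have : v e * v e ≤ v x₂ * v e := by gcongr
    rw [hvx₂, ← sq] at this
    exact absurd h (not_lt.2 this)
  -- an isometry permutes the two roots, and these have different valuations
  have hmem : x₁ ∈ rationalClosure v {e, y} := by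
    intro σ h1 h3
    have he : σ e = e := h3 e (by simp)
    have hy : σ y = y := h3 y (by simp)
    have hs' : σ x₁ + σ x₂ = -e := by rw [← map_add, hsum, map_neg, he]
    have hp' : σ x₁ * σ x₂ = -y := by rw [← map_mul, hprod, map_neg, hy]
    have : (σ x₁ - x₁) * (σ x₁ - x₂) = 0 := by
      linear_combination (σ x₁) * (hs' - hsum) - hp' + hprod
    rcases mul_eq_zero.1 this with h4 | h4
    · exact sub_eq_zero.1 h4
    · have h5 := h1 x₁
      rw [sub_eq_zero.1 h4] at h5
      exact absurd h5 hlt.ne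
  refine ⟨x₁, x₂, hsum, hprod, hvx₁, hvx₂, hlt, hmem, ?_⟩
  exact sub_mem (neg_mem (subset_rationalClosure (by simp))) hmem

theorem sub_mul_mem_rationalClosure (b c y : E) : b - y * c ∈ rationalClosure v {b, c, y} :=
  sub_mem (subset_rationalClosure (by simp))
    (mul_mem (subset_rationalClosure (by simp)) (subset_rationalClosure (by simp)))

theorem rationalClosure_disc_le (b c y : E) :
    rationalClosure v {b - y * c, y} ≤ rationalClosure v {b, c, y} :=
  rationalClosure_le (by
    simp only [Set.mem_insert_iff, Set.mem_singleton_iff, forall_eq_or_imp, forall_eq]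
    exact ⟨sub_mul_mem_rationalClosure b c y, subset_rationalClosure (by simp)⟩)

theorem rationalClosure_step {S : Set E} {b c x : E} (hb : b ∈ S) (hc : c ∈ S)
    (hx : x ∈ rationalClosure v S) :
    rationalClosure v {b, c, x} ≤ rationalClosure v S :=
  rationalClosure_le_of_mem (subset_rationalClosure hb) (subset_rationalClosure hc) hx

theorem mul_ne_one_of_one_lt {b c : E} (hb : 1 < v b) (hc : 1 < v c) : b * c ≠ 1 := by
  intro h
  have := congrArg v h
  rw [map_mul, map_one] at this
  exact absurd this (one_lt_mul'' hb hc).ne'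

/-- The main recursion. If `v (y c) ≠ v b`, then `v (b - y c) = max (v b) (v (y c))` is so large that
`φ(x) = y` has two roots of different valuations, and both satisfy the hypothesis on `y`. -/
theorem splitsOver_of_ne (h2 : v 2 = 1) (hsq : ∀ D w, v D = v w ^ 2 → IsSquare D) {b c : E}
    (hb : 1 < v b) (hc : 1 < v c) (n : ℕ) {y : E} (hy : v y * v c ≠ v b) :
    SplitsOver v {b, c, y} (fiberPoly b c n y) := by
  induction n generalizing y with
  | zero => rw [fiberPoly_zero]; exact .X_sub_C (subset_rationalClosure (by simp))
  | succ n ih =>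
    have hmax : v (b - y * c) = max (v b) (v y * v c) := by
      rw [← map_mul]
      rw [sub_eq_add_neg, ← Valuation.map_neg v (y * c)]
      exact Valuation.map_add_of_distinct_val v (by
        rw [Valuation.map_neg, map_mul]; exact hy.symm)
    have heb : v b ≤ v (b - y * c) := by rw [hmax]; exact le_max_left _ _
    have heyc : v y * v c ≤ v (b - y * c) := by rw [hmax]; exact le_max_right _ _
    have he1 : 1 < v (b - y * c) := hb.trans_le heb
    have hye : v y ≤ v (b - y * c) := by
      refine le_trans ?_ heyc
      calc v y = v y * 1 := (mul_one _).symm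
        _ ≤ v y * v c := by gcongr
    have hlt : v y < v (b - y * c) ^ 2 := by
      refine hye.trans_lt ?_
      calc v (b - y * c) = v (b - y * c) ^ 1 := (pow_one _).symm
        _ < _ := pow_lt_pow_right₀ he1 (by norm_num)
    obtain ⟨x₁, x₂, hs, hp, hv₁, hv₂, hlt', hm₁, hm₂⟩ := exists_roots_of_lt h2 hsq hlt
    have he0 : v (b - y * c) ≠ 0 := (zero_lt_one.trans he1).ne'
    have g₁ : v x₁ * v c ≠ v b := by
      rw [hv₁]
      refine ((lt_of_le_of_lt heb ?_)).ne'
      calc v (b - y * c) = v (b - y * c) * 1 := (mul_one _).symm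
        _ < _ := by gcongr; exact zero_lt_iff.2 he0
    have g₂ : v x₂ * v c ≠ v b := by
      refine (lt_of_le_of_lt ?_ hb).ne
      by_contra hcon
      push Not at hcon
      have : 1 * v (b - y * c) < v x₂ * v c * v (b - y * c) := by
        gcongr; exact zero_lt_iff.2 he0
      rw [mul_right_comm, hv₂, one_mul] at this
      exact absurd heyc (not_le.2 this)
    have hcl := rationalClosure_disc_le (v := v) b c y
    refine .fiberPoly_succ (x₁ := x₁) (x₂ := x₂) (mul_ne_one_of_one_lt hb hc)
      (by rw [hs]; ring) hp (fun h => hlt'.ne (by rw [h])) ((ih g₁).mono ?_) ((ih g₂).mono ?_)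
    · exact rationalClosure_step (by simp) (by simp) (hcl hm₁)
    · exact rationalClosure_step (by simp) (by simp) (hcl hm₂)

/-- The case `v (y c) = v b` in which the roots of `φ(x) = y` still have different valuations,
and both fall under `splitsOver_of_ne`. -/
theorem splitsOver_of_lt (h2 : v 2 = 1) (hsq : ∀ D w, v D = v w ^ 2 → IsSquare D) {b c : E}
    (hb : 1 < v b) (hc : 1 < v c) (n : ℕ) {y : E} (hy : v y * v c = v b) (hy1 : 1 ≤ v y)
    (hlt : v y < v (b - y * c) ^ 2) (hne : v (b - y * c) ≠ v y) :
    SplitsOver v {b, c, y} (fiberPoly b c n y) := by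
  cases n with
  | zero => rw [fiberPoly_zero]; exact .X_sub_C (subset_rationalClosure (by simp))
  | succ n =>
    obtain ⟨x₁, x₂, hs, hp, hv₁, hv₂, hlt', hm₁, hm₂⟩ := exists_roots_of_lt h2 hsq hlt
    have hc0 : v c ≠ 0 := (zero_lt_one.trans hc).ne'
    have hy0 : v y ≠ 0 := (zero_lt_one.trans_le hy1).ne'
    have g₁ : v x₁ * v c ≠ v b := by
      rw [hv₁, ← hy]
      exact fun h => hne (mul_right_cancel₀ hc0 h)
    have g₂ : v x₂ * v c ≠ v b := by
      rw [← hy]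
      intro h
      rw [mul_right_cancel₀ hc0 h] at hv₂
      have he1 : v (b - y * c) = 1 := by
        apply mul_left_cancel₀ hy0
        rw [hv₂, mul_one]
      rw [he1, one_pow] at hlt
      exact absurd hy1 (not_le.2 hlt)
    have hcl := rationalClosure_disc_le (v := v) b c y
    refine .fiberPoly_succ (x₁ := x₁) (x₂ := x₂) (mul_ne_one_of_one_lt hb hc)
      (by rw [hs]; ring) hp (fun h => hlt'.ne (by rw [h]))
      ((splitsOver_of_ne h2 hsq hb hc n g₁).mono ?_) ((splitsOver_of_ne h2 hsq hb hc n g₂).mono ?_)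
    · exact rationalClosure_step (by simp) (by simp) (hcl hm₁)
    · exact rationalClosure_step (by simp) (by simp) (hcl hm₂)

variable (v) in
/-- All roots of the polynomial are in the field, at least `m` of them distinct, and they are fixed
by every isometric endomorphism fixing `S` pointwise. -/
structure HasRoots (S : Set E) (m : ℕ) (p : E[X]) : Prop where
  splits : p.Splits
  le_card : ∃ s : Finset E, m ≤ s.card ∧ ∀ r ∈ s, p.IsRoot r
  mem : ∀ r ∈ p.roots, r ∈ rationalClosure v S

theorem SplitsOver.exists_finset {S : Set E} {b c y : E} {n : ℕ}
    (h : SplitsOver v S (fiberPoly b c n y)) :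
    ∃ s : Finset E, 2 ^ n ≤ s.card ∧ ∀ r ∈ s, (fiberPoly b c n y).IsRoot r := by
  classical
  exact ⟨(fiberPoly b c n y).roots.toFinset, h.card_roots.ge, fun r hr =>
    isRoot_of_mem_roots (Multiset.mem_toFinset.1 hr)⟩

theorem SplitsOver.hasRoots {S : Set E} {b c y : E} {n : ℕ}
    (h : SplitsOver v S (fiberPoly b c n y)) :
    HasRoots v S (2 ^ (n - 1)) (fiberPoly b c n y) := by
  obtain ⟨s, hs, hr⟩ := h.exists_finset
  exact ⟨h.splits, ⟨s, (Nat.pow_le_pow_right two_pos (Nat.sub_le _ _)).trans hs, hr⟩, h.mem⟩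

/-- If one of the two factors splits into distinct linear factors, it alone accounts for half of
the degree. -/
theorem hasRoots_succ {S : Set E} {b c y x₁ x₂ : E} {n m : ℕ}
    (hs : x₁ + x₂ = y * c - b) (hp : x₁ * x₂ = -y)
    (h₁ : HasRoots v S m (fiberPoly b c n x₁)) (h₂ : SplitsOver v S (fiberPoly b c n x₂)) :
    HasRoots v S (2 ^ (n + 1 - 1)) (fiberPoly b c (n + 1) y) := by
  rw [fiberPoly_succ n hs hp]
  refine ⟨h₁.splits.mul h₂.splits, ?_, fun r hr => ?_⟩
  · obtain ⟨s, hs, hr⟩ := h₂.exists_finset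
    exact ⟨s, hs, fun r h => root_mul_left_of_isRoot _ (hr r h)⟩
  · rw [roots_mul (mul_ne_zero (fiberPoly_monic ..).ne_zero (fiberPoly_monic ..).ne_zero),
      Multiset.mem_add] at hr
    exact hr.elim (h₁.mem r) (h₂.mem r)

/-- The case of a double root of `φ(x) = y`. -/
theorem hasRoots_succ_of_double {S : Set E} {b c y x : E} {n : ℕ}
    (hs : x + x = y * c - b) (hp : x * x = -y) (h : SplitsOver v S (fiberPoly b c n x)) :
    HasRoots v S (2 ^ (n + 1 - 1)) (fiberPoly b c (n + 1) y) :=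
  hasRoots_succ hs hp h.hasRoots h

/-- The two roots of `x² + e x - y` when `v (e)² ≤ v (y)` have the same valuation. -/
theorem sq_eq_of_le {e y x₁ x₂ : E} (hs : x₁ + x₂ = -e) (hp : x₁ * x₂ = -y)
    (h : v e ^ 2 ≤ v y) : v x₁ ^ 2 = v y := by
  have hp' : v x₁ * v x₂ = v y := by rw [← map_mul, hp, Valuation.map_neg]
  have hs' : v (x₁ + x₂) = v e := by rw [hs, Valuation.map_neg]
  rcases lt_trichotomy (v x₁) (v x₂) with hlt | heq | hlt
  · rw [Valuation.map_add_eq_of_lt_right v hlt] at hs'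
    have hpos : 0 < v x₂ := lt_of_le_of_lt zero_le hlt
    rw [← hs', ← hp', sq] at h
    exact absurd (le_of_mul_le_mul_right h hpos) (not_le.2 hlt)
  · rw [← hp', heq, sq]
  · rw [Valuation.map_add_eq_of_lt_left v hlt] at hs'
    have hpos : 0 < v x₁ := lt_of_le_of_lt zero_le hlt
    rw [← hs', ← hp', sq] at h
    exact absurd (le_of_mul_le_mul_left h hpos) (not_le.2 hlt)

theorem exists_roots_of_isSquare (h20 : (2 : E) ≠ 0) {e y w : E} (hw : e ^ 2 + 4 * y = w * w) :
    ∃ x₁ x₂, x₁ + x₂ = -e ∧ x₁ * x₂ = -y ∧ x₁ - x₂ = w := by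
  refine ⟨(-e + w) / 2, (-e - w) / 2, by field_simp; ring, ?_, by field_simp; ring⟩
  field_simp
  linear_combination hw

variable (v) in
/-- The shape of the fibre polynomials over the valued field: either they split into distinct linear
factors over the field generated by the data and the square root of one element, or they have
enough roots over the field generated by the data. -/
def QuadraticRoots (b c : E) (n : ℕ) (y : E) : Prop :=
  HasRoots v {b, c, y} (2 ^ (n - 1)) (fiberPoly b c n y) ∨
    ∃ w, w ≠ 0 ∧ w ^ 2 ∈ rationalClosure v {b, c, y} ∧
      SplitsOver v {b, c, y, w} (fiberPoly b c n y)

theorem disc_mem_rationalClosure (b c y : E) :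
    (b - y * c) ^ 2 + 4 * y ∈ rationalClosure v {b, c, y} :=
  add_mem (pow_mem (sub_mul_mem_rationalClosure b c y) 2)
    (mul_mem (ofNat_mem _ 4) (subset_rationalClosure (by simp)))

theorem roots_mem_rationalClosure (h20 : (2 : E) ≠ 0) {b c y w x₁ x₂ : E}
    (hs : x₁ + x₂ = -(b - y * c)) (hw : x₁ - x₂ = w) :
    x₁ ∈ rationalClosure v {b, c, y, w} ∧ x₂ ∈ rationalClosure v {b, c, y, w} := by
  have he : b - y * c ∈ rationalClosure v {b, c, y, w} :=
    sub_mem (subset_rationalClosure (by simp))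
      (mul_mem (subset_rationalClosure (by simp)) (subset_rationalClosure (by simp)))
  have hw' : w ∈ rationalClosure v {b, c, y, w} := subset_rationalClosure (by simp)
  have h1 : x₁ = (-(b - y * c) + w) / 2 := by
    rw [← hs, ← hw]; field_simp; ring
  have h2 : x₂ = (-(b - y * c) - w) / 2 := by
    rw [← hs, ← hw]; field_simp; ring
  constructor
  · rw [h1]; exact div_mem (add_mem (neg_mem he) hw') (ofNat_mem _ 2)
  · rw [h2]; exact div_mem (sub_mem (neg_mem he) hw') (ofNat_mem _ 2)

theorem half_mem_rationalClosure (h20 : (2 : E) ≠ 0) {b c y x : E}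
    (hs : x + x = -(b - y * c)) : x ∈ rationalClosure v {b, c, y} := by
  have h1 : x = -(b - y * c) / 2 := by rw [← hs]; field_simp; ring
  rw [h1]
  exact div_mem (neg_mem (sub_mul_mem_rationalClosure b c y)) (ofNat_mem _ 2)

/-- From two roots `x₁`, `x₂` of `φ(x) = y` for which the fibre polynomials split. -/
theorem quadraticRoots_succ (h20 : (2 : E) ≠ 0) {b c y x₁ x₂ : E} {n : ℕ} (hbc : b * c ≠ 1)
    (hs : x₁ + x₂ = -(b - y * c)) (hp : x₁ * x₂ = -y)
    (h₁ : SplitsOver v {b, c, x₁} (fiberPoly b c n x₁))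
    (h₂ : SplitsOver v {b, c, x₂} (fiberPoly b c n x₂)) :
    QuadraticRoots v b c (n + 1) y := by
  have hs' : x₁ + x₂ = y * c - b := by rw [hs]; ring
  by_cases hne : x₁ = x₂
  · subst hne
    exact .inl (hasRoots_succ_of_double hs' hp (h₁.mono
      (rationalClosure_step (by simp) (by simp) (half_mem_rationalClosure h20 hs))))
  · obtain ⟨m₁, m₂⟩ := roots_mem_rationalClosure (v := v) h20 hs rfl
    refine .inr ⟨x₁ - x₂, sub_ne_zero.2 hne, ?_, .fiberPoly_succ hbc hs' hp hne (h₁.mono ?_)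
      (h₂.mono ?_)⟩
    · have : (x₁ - x₂) ^ 2 = (b - y * c) ^ 2 + 4 * y := by
        linear_combination (x₁ + x₂ - (b - y * c)) * hs - 4 * hp
      rw [this]
      exact disc_mem_rationalClosure b c y
    · exact rationalClosure_step (by simp) (by simp) m₁
    · exact rationalClosure_step (by simp) (by simp) m₂

/-- The case `v (y c) = v b` and `1 < v y`. At most one root of `φ(x) = y` has the same
property, and then the other one falls under `splitsOver_of_ne`. -/
theorem quadraticRoots_of_one_lt (h2 : v 2 = 1) (hsq : ∀ D w, v D = v w ^ 2 → IsSquare D)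
    {b c : E} (hb : 1 < v b) (hc : 1 < v c) (n : ℕ) {y : E} (hy : v y * v c = v b)
    (hy1 : 1 < v y) (hD : ∀ D ∈ rationalClosure v {b, c, y}, IsSquare D) :
    QuadraticRoots v b c n y := by
  have h20 : (2 : E) ≠ 0 := fun h0 => by simp [h0] at h2
  have hbc := mul_ne_one_of_one_lt hb hc
  have hc0 : v c ≠ 0 := (zero_lt_one.trans hc).ne'
  have hy0 : v y ≠ 0 := (zero_lt_one.trans hy1).ne'
  induction n generalizing y with
  | zero =>
    refine .inl (SplitsOver.hasRoots ?_)
    rw [fiberPoly_zero]; exact .X_sub_C (subset_rationalClosure (by simp))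
  | succ n ih =>
    rcases lt_or_ge (v y) (v (b - y * c) ^ 2) with hlt | hle
    -- the larger root may satisfy `v (x₁ c) = v b` again; the smaller one never does
    · by_cases hey : v (b - y * c) = v y
      · obtain ⟨x₁, x₂, hs, hp, hv₁, hv₂, hlt', hm₁, hm₂⟩ := exists_roots_of_lt h2 hsq hlt
        have hcl := rationalClosure_disc_le (v := v) b c y
        have hcl₁ : rationalClosure v {b, c, x₁} ≤ rationalClosure v {b, c, y} :=
          rationalClosure_step (by simp) (by simp) (hcl hm₁)
        have hcl₂ : rationalClosure v {b, c, x₂} ≤ rationalClosure v {b, c, y} :=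
          rationalClosure_step (by simp) (by simp) (hcl hm₂)
        rw [hey] at hv₁ hv₂
        have hv₂' : v x₂ = 1 := mul_right_cancel₀ hy0 (by rw [hv₂, one_mul])
        have hs' : x₁ + x₂ = y * c - b := by rw [hs]; ring
        have g₂ : v x₂ * v c ≠ v b := by
          rw [← hy]
          intro h
          rw [mul_right_cancel₀ hc0 h] at hv₂'
          exact hy1.ne' hv₂'
        have s₂ := splitsOver_of_ne h2 hsq hb hc n g₂
        have h₁ := ih (y := x₁) (by rw [hv₁, hy]) (by rw [hv₁]; exact hy1)
          (fun D hD' => hD D (hcl₁ hD')) (by rw [hv₁]; exact hy0)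
        rcases h₁ with h₁ | ⟨w, hw0, hw, h₁⟩
        · exact .inl (hasRoots_succ hs' hp ⟨h₁.splits, h₁.le_card, fun r hr => hcl₁ (h₁.mem r hr)⟩
            (s₂.mono hcl₂))
        · have hcly : rationalClosure v {b, c, y} ≤ rationalClosure v {b, c, y, w} :=
            rationalClosure_le_of_mem (subset_rationalClosure (by simp))
              (subset_rationalClosure (by simp)) (subset_rationalClosure (by simp))
          refine .inr ⟨w, hw0, hcl₁ hw, .fiberPoly_succ hbc hs' hp (fun h => hlt'.ne (by rw [h]))
            (h₁.mono ?_) (s₂.mono (hcl₂.trans hcly))⟩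
          refine rationalClosure_le ?_
          simp only [Set.mem_insert_iff, Set.mem_singleton_iff, forall_eq_or_imp, forall_eq]
          exact ⟨subset_rationalClosure (by simp), subset_rationalClosure (by simp),
            hcly (hcl hm₁), subset_rationalClosure (by simp)⟩
      · exact .inl (splitsOver_of_lt h2 hsq hb hc _ hy hy1.le hlt hey).hasRoots
    -- both roots have valuation `√(v y)`, which differs from `v y`
    · obtain ⟨w, hw⟩ := hD _ (disc_mem_rationalClosure b c y)
      obtain ⟨x₁, x₂, hs, hp, -⟩ := exists_roots_of_isSquare h20 hw
      have good : ∀ x, v x ^ 2 = v y → v x * v c ≠ v b := by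
        intro x hx h
        rw [← hy] at h
        rw [mul_right_cancel₀ hc0 h, sq] at hx
        exact hy1.ne' (mul_right_cancel₀ hy0 (by rw [hx, one_mul]))
      exact quadraticRoots_succ h20 hbc hs hp
        (splitsOver_of_ne h2 hsq hb hc n (good _ (sq_eq_of_le hs hp hle)))
        (splitsOver_of_ne h2 hsq hb hc n (good _ (sq_eq_of_le (by rw [add_comm, hs])
          (by rw [mul_comm, hp]) hle)))

/-- The point `y` is fixed by `φ`, and the other solution of `φ(x) = y` is `x = -1`. -/
theorem splitsOver_of_fixed (h2 : v 2 = 1) (hsq : ∀ D w, v D = v w ^ 2 → IsSquare D) {b c : E}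
    (hb : 1 < v b) (hc : 1 < v c) (hbc : v c = v b) (n : ℕ) {y : E} (hy : v (y + 1) = 1)
    (he1 : v (b - y * c) ≤ 1) (he : b - y * c = 1 - y) :
    SplitsOver v {b, c, y} (fiberPoly b c n y) := by
  induction n with
  | zero => rw [fiberPoly_zero]; exact .X_sub_C (subset_rationalClosure (by simp))
  | succ n ih =>
    have hv : v (b - (-1) * c) = v c := by
      have : b - (-1) * c = (y + 1) * c + (b - y * c) := by ring
      rw [this, Valuation.map_add_eq_of_lt_left, map_mul, hy, one_mul]
      rw [map_mul, hy, one_mul]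
      exact he1.trans_lt hc
    have hs : SplitsOver v {b, c, -1} (fiberPoly b c n (-1)) := by
      have hm1 : v (-1 : E) = 1 := by rw [Valuation.map_neg, map_one]
      refine splitsOver_of_lt h2 hsq hb hc n ?_ ?_ ?_ ?_
      · rw [hm1, one_mul, hbc]
      · rw [hm1]
      · rw [hm1, hv]; exact one_lt_pow₀ hc two_ne_zero
      · rw [hm1, hv]; exact hc.ne'
    refine .fiberPoly_succ (x₁ := y) (x₂ := -1) (mul_ne_one_of_one_lt hb hc)
      (by linear_combination he) (by ring) ?_ ih (hs.mono ?_)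
    · rintro rfl
      simp at hy
    · exact rationalClosure_step (by simp) (by simp) (neg_mem (one_mem _))

theorem fiberPoly_neg_one {b c : E} (h : b + c = 2) (n : ℕ) :
    fiberPoly b c n (-1) = (X - C (-1)) ^ 2 ^ n := by
  induction n with
  | zero => simp [fiberPoly_zero]
  | succ n ih =>
    rw [fiberPoly_succ (x₁ := -1) (x₂ := -1) n (by linear_combination h) (by ring), ih]
    ring

/-- The case `v b = v c` and `v y = 1` with `b - y c` integral, when the residues of the roots of
`φ(x) = y` decide whether they equal `-1`. -/
theorem quadraticRoots_of_eq_one (h2 : v 2 = 1) (hsq : ∀ D w, v D = v w ^ 2 → IsSquare D)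
    {b c : E} (hb : 1 < v b) (hc : 1 < v c) (n : ℕ) {y : E} (hbc : v c = v b)
    (hy1 : v y = 1) (he : v (b - y * c) ≤ 1) (hD : ∀ D ∈ rationalClosure v {b, c, y}, IsSquare D)
    (hconst : ∀ x₁ x₂, x₁ + x₂ = -(b - y * c) → x₁ * x₂ = -y → x₁ = -1 ∨ v (x₁ + 1) = 1)
    (hexc : ¬ (2 ≤ n ∧ y = -1 ∧ b + c = 2)) :
    QuadraticRoots v b c n y := by
  have h20 : (2 : E) ≠ 0 := fun h0 => by simp [h0] at h2
  cases n with
  | zero =>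
    refine .inl (SplitsOver.hasRoots ?_)
    rw [fiberPoly_zero]; exact .X_sub_C (subset_rationalClosure (by simp))
  | succ n =>
    obtain ⟨w, hw⟩ := hD _ (disc_mem_rationalClosure b c y)
    obtain ⟨x₁, x₂, hs, hp, -⟩ := exists_roots_of_isSquare h20 hw
    have hs' : x₂ + x₁ = -(b - y * c) := by rw [add_comm, hs]
    have hp' : x₂ * x₁ = -y := by rw [mul_comm, hp]
    have he2 : v (b - y * c) ^ 2 ≤ v y := by rw [hy1]; exact pow_le_one₀ zero_le he
    have hv : ∀ z, v z ^ 2 = v y → v z = 1 := fun z hz => by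
      rw [hy1] at hz
      exact (pow_eq_one_iff_of_nonneg zero_le two_ne_zero).1 hz
    have hv₁ := hv _ (sq_eq_of_le hs hp he2)
    have hv₂ := hv _ (sq_eq_of_le hs' hp' he2)
    -- the fibre over a root splits when the other root is not `-1`
    have good : ∀ x z, x + z = -(b - y * c) → x * z = -y → v x = 1 → v (z + 1) = 1 →
        SplitsOver v {b, c, x} (fiberPoly b c n x) := by
      intro x z hs hp hx hz
      have hvc : v (b - x * c) = v c := by
        have : b - x * c = -(x * (z + 1) * c) + (b - y * c) := by linear_combination c * hp
        rw [this, Valuation.map_add_eq_of_lt_left] <;>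
          rw [Valuation.map_neg, map_mul, map_mul, hz, hx, one_mul, one_mul]
        exact he.trans_lt hc
      refine splitsOver_of_lt h2 hsq hb hc n ?_ ?_ ?_ ?_
      · rw [hx, one_mul, hbc]
      · rw [hx]
      · rw [hx, hvc]; exact one_lt_pow₀ hc two_ne_zero
      · rw [hx, hvc]; exact hc.ne'
    -- one root equal to `-1` makes `y` a fixed point
    have fixed : ∀ z, -1 + z = -(b - y * c) → -1 * z = -y → v (z + 1) = 1 →
        QuadraticRoots v b c (n + 1) y := by
      intro z hs hp hz
      have hzy : z = y := by linear_combination -hp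
      subst hzy
      exact .inl (splitsOver_of_fixed h2 hsq hb hc hbc _ hz he (by linear_combination hs)).hasRoots
    rcases hconst x₁ x₂ hs hp with h₁ | h₁ <;> rcases hconst x₂ x₁ hs' hp' with h₂ | h₂
    -- both roots equal to `-1` is the excluded case, apart from `n + 1 = 1`
    · subst h₁ h₂
      have hy : y = -1 := by linear_combination hp
      subst hy
      have hbc2 : b + c = 2 := by linear_combination hs
      have hn : n = 0 := by
        by_contra hn
        exact hexc ⟨by omega, rfl, hbc2⟩
      subst hn
      refine .inl ?_
      refine hasRoots_succ_of_double (x := -1) (by linear_combination hbc2) (by ring) ?_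
      rw [fiberPoly_zero]
      exact .X_sub_C (neg_mem (one_mem _))
    · subst h₁
      exact fixed x₂ hs hp h₂
    · subst h₂
      exact fixed x₁ hs' hp' h₁
    · exact quadraticRoots_succ h20 (mul_ne_one_of_one_lt hb hc) hs hp
        (good x₁ x₂ hs hp hv₁ h₂) (good x₂ x₁ hs' hp' hv₂ h₁)

/-- The fibre polynomials outside of the exceptional case. The hypothesis `hD` says that everything
rational over the data is a square in the field, and `hconst` is vacuous unless `y` and `b - y c`
are units or smaller. -/
theorem quadraticRoots_of_one_le (h2 : v 2 = 1) (hsq : ∀ D w, v D = v w ^ 2 → IsSquare D)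
    {b c : E} (hb : 1 < v b) (hc : 1 < v c) (n : ℕ) {y : E} (hy : y = 0 ∨ 1 ≤ v y)
    (hD : ∀ D ∈ rationalClosure v {b, c, y}, IsSquare D)
    (hconst : v y = 1 → v (b - y * c) ≤ 1 →
      ∀ x₁ x₂, x₁ + x₂ = -(b - y * c) → x₁ * x₂ = -y → x₁ = -1 ∨ v (x₁ + 1) = 1)
    (hexc : ¬ (2 ≤ n ∧ y = -1 ∧ b + c = 2)) :
    QuadraticRoots v b c n y := by
  by_cases hg : v y * v c = v b
  · have hy1 : 1 ≤ v y := by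
      rcases hy with rfl | hy
      · rw [map_zero, zero_mul] at hg
        exact absurd (hg ▸ hb) (not_lt.2 zero_le)
      · exact hy
    rcases hy1.lt_or_eq with hy1 | hy1
    · exact quadraticRoots_of_one_lt h2 hsq hb hc n hg hy1 hD
    · rcases le_or_gt (v (b - y * c)) 1 with he | he
      · exact quadraticRoots_of_eq_one h2 hsq hb hc n (by rw [← hg, ← hy1, one_mul]) hy1.symm he hD
          (hconst hy1.symm he) hexc
      · refine .inl (splitsOver_of_lt h2 hsq hb hc n hg hy1.le ?_ ?_).hasRoots
        · rw [← hy1]; exact one_lt_pow₀ he two_ne_zero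
        · rw [← hy1]; exact he.ne'
  · exact .inl (splitsOver_of_ne h2 hsq hb hc n hg).hasRoots

end RootTree

/-! ### Laurent series in a square root of `t⁻¹` -/

section Laurent

variable {k : Type*} [Field k]

variable (k) in
/-- The valuation on Laurent series given by the order of vanishing, written multiplicatively. -/
def ordVal : Valuation (LaurentSeries k) (Multiplicative (WithTop ℤ)ᵒᵈ) :=
  AddValuation.toValuation (HahnSeries.addVal ℤ k)

theorem ordVal_le_iff {x y : LaurentSeries k} :
    ordVal k x ≤ ordVal k y ↔ y.orderTop ≤ x.orderTop := Iff.rfl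

theorem ordVal_eq_iff {x y : LaurentSeries k} :
    ordVal k x = ordVal k y ↔ x.orderTop = y.orderTop := by
  rw [le_antisymm_iff, le_antisymm_iff, ordVal_le_iff, ordVal_le_iff, and_comm]

theorem ordVal_lt_iff {x y : LaurentSeries k} :
    ordVal k x < ordVal k y ↔ y.orderTop < x.orderTop := Iff.rfl

theorem ordVal_eq_of_support {x y : LaurentSeries k} (h : ∀ n, x.coeff n = 0 ↔ y.coeff n = 0) :
    ordVal k x = ordVal k y := by
  rw [ordVal_eq_iff]
  apply le_antisymm <;> rw [HahnSeries.le_orderTop_iff_forall] <;> intro n hn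
  · exact (h n).1 (HahnSeries.coeff_eq_zero_of_lt_orderTop hn)
  · exact (h n).2 (HahnSeries.coeff_eq_zero_of_lt_orderTop hn)

theorem ordVal_C {r : k} (hr : r ≠ 0) : ordVal k (HahnSeries.C r) = 1 := by
  rw [← map_one (ordVal k), ordVal_eq_iff, HahnSeries.orderTop_one, HahnSeries.C_apply,
    HahnSeries.orderTop_single hr]
  rfl

/-- The embedding of `k[t]` in the field of Laurent series in `s` given by `t = s⁻²`: the completion
at `t = ∞`, with a square root of the uniformizer adjoined. -/
def param : k[X] →+* LaurentSeries k :=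
  eval₂RingHom HahnSeries.C (HahnSeries.single (-2) 1)

theorem param_C (r : k) : param (C r) = HahnSeries.C r := by simp [param]

theorem param_X : param (X : k[X]) = HahnSeries.single (-2) 1 := by simp [param]

theorem single_neg_two_pow (m : ℕ) :
    (HahnSeries.single (-2 : ℤ) (1 : k)) ^ m = HahnSeries.single (-2 * (m : ℤ)) 1 := by
  rw [HahnSeries.single_pow]; simp [mul_comm]

theorem param_monomial (m : ℕ) (r : k) :
    param (monomial m r) = HahnSeries.single (-2 * (m : ℤ)) r := by
  rw [← C_mul_X_pow_eq_monomial, map_mul, map_pow, param_C, param_X, single_neg_two_pow,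
    HahnSeries.C_apply, HahnSeries.single_mul_single]
  simp

theorem coeff_param (p : k[X]) (m : ℕ) : (param p).coeff (-2 * (m : ℤ)) = p.coeff m := by
  induction p using Polynomial.induction_on' with
  | add p q hp hq => rw [map_add, HahnSeries.coeff_add, hp, hq, coeff_add]
  | monomial n r =>
    rw [param_monomial, HahnSeries.coeff_single, coeff_monomial]
    by_cases h : n = m
    · simp [h]
    · rw [if_neg h, if_neg (by omega)]

theorem coeff_param_eq_zero (p : k[X]) {n : ℤ} (h : ∀ m : ℕ, n ≠ -2 * m) :
    (param p).coeff n = 0 := by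
  induction p using Polynomial.induction_on' with
  | add p q hp hq => rw [map_add, HahnSeries.coeff_add, hp, hq, add_zero]
  | monomial m r => rw [param_monomial, HahnSeries.coeff_single_of_ne (h m)]

theorem orderTop_param {p : k[X]} (hp : p ≠ 0) :
    (param p).orderTop = ((-2 * (p.natDegree : ℤ) : ℤ) : WithTop ℤ) := by
  apply HahnSeries.orderTop_eq_of_le
  · rw [HahnSeries.mem_support, coeff_param]
    exact mt leadingCoeff_eq_zero.1 hp
  · intro n hn
    rw [HahnSeries.mem_support] at hn
    by_contra hlt
    push Not at hlt
    apply hn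
    by_cases h : ∃ m : ℕ, n = -2 * m
    · obtain ⟨m, rfl⟩ := h
      rw [coeff_param]
      exact coeff_eq_zero_of_natDegree_lt (by omega)
    · push Not at h
      exact coeff_param_eq_zero p h

theorem param_injective : Function.Injective (param : k[X] →+* LaurentSeries k) := by
  rw [injective_iff_map_eq_zero]
  intro p hp
  ext m
  rw [← coeff_param, hp]
  simp

theorem ordVal_param_le_iff {p q : k[X]} (hp : p ≠ 0) (hq : q ≠ 0) :
    ordVal k (param p) ≤ ordVal k (param q) ↔ p.natDegree ≤ q.natDegree := by
  rw [ordVal_le_iff, orderTop_param hp, orderTop_param hq, WithTop.coe_le_coe]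
  omega

theorem exists_le_ordVal_pow (z : LaurentSeries k) :
    ∃ n : ℕ, ∀ m ≥ n, ordVal k z ≤ ordVal k (param (X ^ m)) := by
  by_cases hz : z = 0
  · exact ⟨0, fun m _ => by simp [hz]⟩
  refine ⟨z.order.natAbs, fun m hm => ?_⟩
  rw [ordVal_le_iff, orderTop_param (pow_ne_zero m X_ne_zero), natDegree_X_pow,
    ← HahnSeries.order_eq_orderTop_of_ne_zero hz, WithTop.coe_le_coe]
  omega

theorem one_lt_ordVal_param {p : k[X]} (hp : 0 < p.natDegree) : 1 < ordVal k (param p) := by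
  have h0 : p ≠ 0 := by rintro rfl; simp at hp
  rw [← map_one (ordVal k), ← map_one param, ← not_le, ordVal_param_le_iff h0 one_ne_zero]
  simpa using hp.ne'

/-- The change of variable `s ↦ -s`, whose fixed points are the Laurent series in `s² = t⁻¹`. -/
def flip : LaurentSeries k →+* LaurentSeries k where
  toFun x := ⟨fun n => (n.negOnePow : k) * x.coeff n,
    x.isPWO_support.mono fun n hn h => hn (by simp [h])⟩
  map_one' := by
    ext n
    by_cases hn : n = 0 <;> simp [HahnSeries.coeff_one, hn]
  map_zero' := by ext n; simp
  map_add' x y := by ext n; simp [mul_add]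
  map_mul' x y := by
    ext n
    simp only [HahnSeries.coeff_mul, Finset.mul_sum]
    refine Finset.sum_congr ?_ fun ij hij => ?_
    · ext ij
      simp
    · have : n = ij.1 + ij.2 := by
        have := (Finset.mem_antidiagonal.1 hij).2.2
        exact this.symm
      rw [this, Int.negOnePow_add]
      push_cast
      ring

theorem coeff_flip (x : LaurentSeries k) (n : ℤ) : (flip x).coeff n = n.negOnePow * x.coeff n := rfl

theorem ordVal_flip (x : LaurentSeries k) : ordVal k (flip x) = ordVal k x :=
  ordVal_eq_of_support fun n => by simp [coeff_flip]

theorem flip_flip (x : LaurentSeries k) : flip (flip x) = x := by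
  ext n
  rw [coeff_flip, coeff_flip, ← mul_assoc]
  have : ((n.negOnePow * n.negOnePow : ℤˣ) : ℤ) = 1 := by rw [Int.units_mul_self]; rfl
  have h : (((n.negOnePow : ℤ) * (n.negOnePow : ℤ) : ℤ) : k) = 1 := by
    rw [← Units.val_mul, this]; simp
  push_cast at h
  rw [h, one_mul]

theorem flip_param (p : k[X]) : flip (param p) = param p := by
  ext n
  rw [coeff_flip]
  by_cases h : ∃ m : ℕ, n = -2 * m
  · obtain ⟨m, rfl⟩ := h
    rw [Int.negOnePow_even _ ⟨-m, by ring⟩]; simp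
  · push Not at h
    rw [coeff_param_eq_zero p h, mul_zero]

theorem coeff_eq_zero_of_flip [NeZero (2 : k)] {x : LaurentSeries k} (hx : flip x = x) {n : ℤ}
    (hn : ¬ Even n) : x.coeff n = 0 := by
  have h := congrArg (fun z => HahnSeries.coeff z n) hx
  simp only [coeff_flip] at h
  rw [Int.negOnePow_odd _ (Int.not_even_iff_odd.1 hn)] at h
  have h2 : (2 : k) * x.coeff n = 0 := by
    push_cast at h; linear_combination -h
  exact (mul_eq_zero.1 h2).resolve_left (NeZero.ne _)

/-- An endomorphism of the field of coefficients acts on Laurent series. -/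
def mapCoeff (σ : k →+* k) : LaurentSeries k →+* LaurentSeries k where
  toFun x := x.map σ
  map_one' := by ext n; by_cases hn : n = 0 <;> simp [HahnSeries.coeff_one, hn]
  map_zero' := by ext n; simp
  map_add' x y := by ext n; simp
  map_mul' x y := HahnSeries.map_mul σ.toNonUnitalRingHom

theorem coeff_mapCoeff (σ : k →+* k) (x : LaurentSeries k) (n : ℤ) :
    (mapCoeff σ x).coeff n = σ (x.coeff n) := rfl

theorem ordVal_mapCoeff (σ : k →+* k) (x : LaurentSeries k) :
    ordVal k (mapCoeff σ x) = ordVal k x :=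
  ordVal_eq_of_support fun n => by simp [coeff_mapCoeff]

theorem mapCoeff_param (σ : k →+* k) (p : k[X]) :
    mapCoeff σ (param p) = param (p.map σ) := by
  ext n
  rw [coeff_mapCoeff]
  by_cases h : ∃ m : ℕ, n = -2 * m
  · obtain ⟨m, rfl⟩ := h
    rw [coeff_param, coeff_param, coeff_map]
  · push Not at h
    rw [coeff_param_eq_zero _ h, coeff_param_eq_zero _ h, map_zero]

/-- A series in `s²` agrees with a polynomial in `t = s⁻²` up to terms of positive order. -/
theorem exists_param_sub_lt_one [NeZero (2 : k)] {x : LaurentSeries k} (hx : flip x = x) :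
    ∃ p : k[X], ordVal k (x - param p) < 1 := by
  refine ⟨∑ m ∈ Finset.range (x.order.natAbs + 1), monomial m (x.coeff (-2 * (m : ℤ))), ?_⟩
  rw [← map_one (ordVal k), ordVal_lt_iff, HahnSeries.orderTop_one]
  have key : ((1 : ℤ) : WithTop ℤ) ≤ (x - param (∑ m ∈ Finset.range (x.order.natAbs + 1),
      monomial m (x.coeff (-2 * (m : ℤ))))).orderTop := by
    rw [HahnSeries.le_orderTop_iff_forall]
    intro n hn
    rw [WithTop.coe_lt_coe] at hn
    rw [HahnSeries.coeff_sub]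
    by_cases h : ∃ m : ℕ, n = -2 * m
    · obtain ⟨m, rfl⟩ := h
      rw [coeff_param, finsetSum_coeff]
      simp only [coeff_monomial, Finset.sum_ite_eq', Finset.mem_range]
      split_ifs with hm
      · rw [sub_self]
      · rw [sub_zero]
        exact HahnSeries.coeff_eq_zero_of_lt_order (by omega)
    · have h' := h
      push Not at h'
      rw [coeff_param_eq_zero _ h', sub_zero]
      apply coeff_eq_zero_of_flip hx
      rintro ⟨r, hr⟩
      exact h ⟨(-r).toNat, by omega⟩
  exact lt_of_lt_of_le (WithTop.coe_lt_coe.2 one_pos) key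

/-- The square root is the binomial series for the exponent `1 / 2`. -/
theorem isSquare_one_add [CharZero k] {f : PowerSeries k} (hf : f.constantCoeff = 0) :
    IsSquare (1 + f) := by
  have hs : PowerSeries.HasSubst f := PowerSeries.HasSubst.of_constantCoeff_zero' hf
  have h := PowerSeries.binomialSeries_add (A := k) (1 / 2 : ℚ) (1 / 2)
  have h1 := PowerSeries.binomialSeries_nat (R := ℚ) (A := k) 1
  rw [show (1 / 2 + 1 / 2 : ℚ) = ((1 : ℕ) : ℚ) by norm_num, h1, pow_one] at h
  have h3 := congrArg (PowerSeries.substAlgHom (R := k) hs) h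
  rw [map_add, map_one, map_mul, PowerSeries.substAlgHom_X hs] at h3
  exact ⟨_, h3⟩

theorem isSquare_of_even_order [IsAlgClosed k] [CharZero k] {x : LaurentSeries k}
    (hx : Even x.order) : IsSquare x := by
  by_cases h0 : x = 0
  · exact ⟨0, by simp [h0]⟩
  obtain ⟨m, hm⟩ := hx
  set f := LaurentSeries.powerSeriesPart x
  have hlc : PowerSeries.constantCoeff f = x.coeff x.order := by
    rw [← PowerSeries.coeff_zero_eq_constantCoeff_apply, LaurentSeries.powerSeriesPart_coeff]
    simp
  set r := x.coeff x.order
  have hr : r ≠ 0 := mt HahnSeries.coeff_order_eq_zero.1 h0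
  obtain ⟨z, hz⟩ := IsAlgClosed.exists_pow_nat_eq r (n := 2) two_pos
  obtain ⟨g, hg⟩ := isSquare_one_add (f := PowerSeries.C r⁻¹ * f - 1)
    (by simp [hlc, hr])
  have hf : f = PowerSeries.C r * (g * g) := by
    rw [← hg, add_sub_cancel, ← mul_assoc, ← map_mul, mul_inv_cancel₀ hr, map_one, one_mul]
  refine ⟨HahnSeries.single m z * HahnSeries.ofPowerSeries ℤ k g, ?_⟩
  rw [← LaurentSeries.single_order_mul_powerSeriesPart x]
  change _ * (HahnSeries.ofPowerSeries ℤ k f) = _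
  rw [hf, map_mul, map_mul, HahnSeries.ofPowerSeries_C, HahnSeries.C_apply, ← mul_assoc,
    HahnSeries.single_mul_single, hm, add_zero, one_mul, ← hz, sq, ← HahnSeries.single_mul_single]
  ring

theorem isSquare_of_ordVal_eq [IsAlgClosed k] [CharZero k] (x w : LaurentSeries k)
    (h : ordVal k x = ordVal k w ^ 2) : IsSquare x := by
  by_cases hw : w = 0
  · rw [hw, map_zero, zero_pow two_ne_zero, map_eq_zero] at h
    exact ⟨0, by simp [h]⟩
  have hx : x ≠ 0 := by
    rintro rfl
    rw [map_zero] at h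
    exact pow_ne_zero 2 ((_root_.map_ne_zero _).2 hw) h.symm
  rw [← map_pow, ordVal_eq_iff, ← HahnSeries.order_eq_orderTop_of_ne_zero hx,
    ← HahnSeries.order_eq_orderTop_of_ne_zero (pow_ne_zero 2 hw), WithTop.coe_inj,
    HahnSeries.order_pow] at h
  exact isSquare_of_even_order (by rw [h]; exact ⟨w.order, by simp; ring⟩)

/-- A series in `t⁻¹` has even order in `s`, hence a square root in `k((s))`. -/
theorem isSquare_of_flip [IsAlgClosed k] [CharZero k] {x : LaurentSeries k} (h : flip x = x) :
    IsSquare x := by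
  by_cases h0 : x = 0
  · exact ⟨0, by simp [h0]⟩
  refine isSquare_of_even_order ?_
  by_contra hodd
  exact h0 (HahnSeries.coeff_order_eq_zero.1 (coeff_eq_zero_of_flip h hodd))

end Laurent

/-! ### The fibre polynomials over Laurent series -/

section Fibre

variable {k : Type*} [Field k]

theorem map_iterNumDen {E : Type*} [Field E] (ι : k[X] →+* E) (b c : k[X]) (n : ℕ) :
    (iterNumDen b c n).1.map ι = (iterPair (ι b) (ι c) n).1 ∧
      (iterNumDen b c n).2.map ι = (iterPair (ι b) (ι c) n).2 := by
  induction n with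
  | zero => simp [iterNumDen, iterPair]
  | succ n ih =>
    obtain ⟨h1, h2⟩ := ih
    simp [iterNumDen, iterPair, h1, h2]

theorem map_preimagePoly {E : Type*} [Field E] (ι : k[X] →+* E) (a b c : k[X]) (n : ℕ) :
    (preimagePoly a b c n).map ι = fiberPoly (ι b) (ι c) n (ι a) := by
  obtain ⟨h1, h2⟩ := map_iterNumDen ι b c n
  simp [preimagePoly, fiberPoly, h1, h2]

theorem map_map_iterNumDen {l : Type*} [Field l] (σ : k →+* l) (b c : k[X]) (n : ℕ) :
    (iterNumDen b c n).1.map (mapRingHom σ) = (iterNumDen (b.map σ) (c.map σ) n).1 ∧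
      (iterNumDen b c n).2.map (mapRingHom σ) = (iterNumDen (b.map σ) (c.map σ) n).2 := by
  induction n with
  | zero => simp [iterNumDen]
  | succ n ih =>
    obtain ⟨h1, h2⟩ := ih
    simp [iterNumDen, h1, h2]

theorem map_map_preimagePoly {l : Type*} [Field l] (σ : k →+* l) (a b c : k[X]) (n : ℕ) :
    (preimagePoly a b c n).map (mapRingHom σ) =
      preimagePoly (a.map σ) (b.map σ) (c.map σ) n := by
  obtain ⟨h1, h2⟩ := map_map_iterNumDen σ b c n
  simp [preimagePoly, h1, h2]

variable [CharZero k]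

theorem ordVal_two : ordVal k 2 = 1 := by
  rw [← map_ofNat HahnSeries.C 2]
  exact ordVal_C two_ne_zero

theorem exists_C_of_ordVal_le_one {p : k[X]} (h : ordVal k (param p) ≤ 1) : ∃ r, p = C r := by
  by_cases h0 : p = 0
  · exact ⟨0, by simp [h0]⟩
  rw [← map_one (ordVal k), ← map_one param, ordVal_param_le_iff h0 one_ne_zero,
    natDegree_one] at h
  exact ⟨_, eq_C_of_natDegree_le_zero h⟩

variable [IsAlgClosed k]

theorem isSquare_of_mem_rationalClosure {a b c : k[X]} {D : LaurentSeries k}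
    (hD : D ∈ rationalClosure (ordVal k) {param b, param c, param a}) : IsSquare D :=
  isSquare_of_flip (hD flip ordVal_flip (by simp [flip_param]))

theorem splitsOver_of_degree_ne {a b c : k[X]} (hb : 0 < b.natDegree) (hc : 0 < c.natDegree)
    (h : a.degree + c.degree ≠ b.degree) (n : ℕ) :
    SplitsOver (ordVal k) {param b, param c, param a}
      (fiberPoly (param b) (param c) n (param a)) := by
  refine splitsOver_of_ne ordVal_two isSquare_of_ordVal_eq (one_lt_ordVal_param hb)
    (one_lt_ordVal_param hc) n ?_
  have hb0 : b ≠ 0 := by rintro rfl; simp at hb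
  rw [← map_mul, ← map_mul]
  intro heq
  have hac : a * c ≠ 0 := by
    intro h0
    rw [h0, map_zero, map_zero, eq_comm, map_eq_zero, map_eq_zero_iff _ param_injective] at heq
    exact hb0 heq
  have h1 := (ordVal_param_le_iff hac hb0).1 heq.le
  have h2 := (ordVal_param_le_iff hb0 hac).1 heq.ge
  rw [← degree_mul] at h
  rw [degree_eq_natDegree hac, degree_eq_natDegree hb0] at h
  exact h (by rw [le_antisymm h1 h2])

/-- For constants `a` and `b - a c`, the roots of `φ(x) = a` are constants, so a root different from
`-1` has residue different from `-1`. -/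
theorem quadraticRoots_param {a b c : k[X]} (hb : 0 < b.natDegree) (hc : 0 < c.natDegree)
    (n : ℕ) (hexc : ¬ (2 ≤ n ∧ a = -1 ∧ b + c = 2)) :
    QuadraticRoots (ordVal k) (param b) (param c) n (param a) := by
  refine quadraticRoots_of_one_le ordVal_two isSquare_of_ordVal_eq (one_lt_ordVal_param hb)
    (one_lt_ordVal_param hc) n ?_ (fun D hD => isSquare_of_mem_rationalClosure hD) ?_ ?_
  · by_cases ha : a = 0
    · left; rw [ha, map_zero]
    · right
      rw [← map_one (ordVal k), ← map_one param, ordVal_param_le_iff one_ne_zero ha, natDegree_one]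
      exact Nat.zero_le _
  · intro ha he x₁ x₂ hs hp
    obtain ⟨α, rfl⟩ := exists_C_of_ordVal_le_one ha.le
    rw [← map_mul, ← map_sub] at he
    obtain ⟨ε, hε⟩ := exists_C_of_ordVal_le_one he
    rw [← map_mul, ← map_sub, hε, param_C] at hs
    rw [param_C] at hp
    -- the roots of `x² + ε x - α` are constants
    obtain ⟨z, hz⟩ := IsAlgClosed.exists_pow_nat_eq (ε ^ 2 + 4 * α) (n := 2) two_pos
    obtain ⟨r₁, r₂, hrs, hrp, -⟩ := exists_roots_of_isSquare (two_ne_zero (α := k))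
      (e := ε) (y := α) (w := z) (by rw [← hz, sq])
    have hrs' : (HahnSeries.C r₁ + HahnSeries.C r₂ : LaurentSeries k) = -HahnSeries.C ε := by
      rw [← map_add, hrs, map_neg]
    have hrp' : (HahnSeries.C r₁ * HahnSeries.C r₂ : LaurentSeries k) = -HahnSeries.C α := by
      rw [← map_mul, hrp, map_neg]
    have hx : ∃ r : k, x₁ = HahnSeries.C r := by
      have : (x₁ - HahnSeries.C r₁) * (x₁ - HahnSeries.C r₂) = 0 := by
        linear_combination x₁ * (hs - hrs') - hp + hrp'
      rcases mul_eq_zero.1 this with h | h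
      · exact ⟨r₁, sub_eq_zero.1 h⟩
      · exact ⟨r₂, sub_eq_zero.1 h⟩
    obtain ⟨r, rfl⟩ := hx
    by_cases hr : r = -1
    · left; rw [hr]; simp
    · right
      rw [← map_one HahnSeries.C, ← map_add]
      exact ordVal_C (fun h => hr (eq_neg_of_add_eq_zero_left h))
  · rintro ⟨h1, h2, h3⟩
    refine hexc ⟨h1, param_injective ?_, param_injective ?_⟩
    · rw [h2, map_neg, map_one]
    · rw [map_add, h3, map_ofNat]

end Fibre

/-! ### Points at infinity from roots in Laurent series -/

/-- Gauss's lemma: a monic irreducible polynomial over `k[t]` generates the ideal of relations of any of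
its roots. -/
theorem eval₂_eq_zero_iff_dvd {k E : Type*} [Field k] [Field E] {ι : k[X] →+* E}
    (hι : Function.Injective ι) {f : k[X][X]} (hf : Irreducible f) (hm : f.Monic) {ρ : E}
    (hρ : f.eval₂ ι ρ = 0) (g : k[X][X]) : g.eval₂ ι ρ = 0 ↔ f ∣ g := by
  let _ := ι.toAlgebra
  have : FaithfulSMul k[X] E := (faithfulSMul_iff_algebraMap_injective _ _).2 hι
  have hint : IsIntegral k[X] ρ := ⟨f, hm, hρ⟩
  have hdvd : minpoly k[X] ρ ∣ f := minpoly.isIntegrallyClosed_dvd hint hρ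
  have hassoc : Associated (minpoly k[X] ρ) f := by
    obtain ⟨g, hg⟩ := hdvd
    have hu := (hf.isUnit_or_isUnit hg).resolve_left (minpoly.not_isUnit k[X] ρ)
    rw [hg]
    exact ⟨hu.unit, rfl⟩
  rw [← hassoc.dvd_iff_dvd_left, ← minpoly.isIntegrallyClosed_dvd_iff hint]
  rfl

theorem separable_map_of_irreducible {k E : Type*} [Field k] [CharZero k] [Field E]
    {ι : k[X] →+* E} (hι : Function.Injective ι) {f : k[X][X]} (hf : Irreducible f)
    (hm : f.Monic) : (f.map ι).Separable := by
  have hirr := (hm.irreducible_iff_irreducible_map_fraction_map (K := FractionRing k[X])).1 hf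
  have : CharZero (FractionRing k[X]) :=
    charZero_of_injective_algebraMap (IsFractionRing.injective k[X] _)
  have hcomp : (IsFractionRing.lift (K := FractionRing k[X]) hι).comp (algebraMap k[X] _) = ι :=
    RingHom.ext fun p => IsFractionRing.lift_algebraMap hι p
  have := hirr.separable.map (f := IsFractionRing.lift (K := FractionRing k[X]) hι)
  rwa [Polynomial.map_map, hcomp] at this

section Component

variable {K : Type*} [Field K] {a b c : K[X]} {N : ℕ}

/-- The equation of `Y(N)` over the algebraic closure. -/
abbrev geomPoly (a b c : K[X]) (N : ℕ) : (AlgebraicClosure K)[X][X] :=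
  (preimagePoly a b c N).map (mapRingHom (algebraMap K (AlgebraicClosure K)))

/-- Evaluation of a polynomial in `x` and `t` at `x = ρ` and `t = s⁻²`. -/
abbrev evalAt {k : Type*} [Field k] (ρ : LaurentSeries k) : k[X][X] →+* LaurentSeries k :=
  eval₂RingHom param ρ

/-- A polynomial in `t` over `K` as a Laurent series in `s` over the algebraic closure. -/
abbrev series (p : K[X]) : LaurentSeries (AlgebraicClosure K) :=
  param (p.map (algebraMap K (AlgebraicClosure K)))

theorem geomPoly_map_param (a b c : K[X]) (N : ℕ) :
    (geomPoly a b c N).map param = fiberPoly (series b) (series c) N (series a) := by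
  rw [geomPoly, map_map_preimagePoly, map_preimagePoly]

theorem geomPoly_monic (a b c : K[X]) (N : ℕ) : (geomPoly a b c N).Monic := by
  refine monic_of_injective param_injective ?_
  rw [geomPoly_map_param]
  exact fiberPoly_monic ..

namespace Component

/-- The defining polynomial of a component can be taken monic in `x`, since `x` is integral over
`k[t]` on `Y(N)`. -/
theorem exists_monic (Y : Component a b c N) : ∃ f : (AlgebraicClosure K)[X][X],
    f.Monic ∧ Irreducible f ∧ Y.ideal = Ideal.span {f} ∧ f ∣ geomPoly a b c N ∧
      Y.degX = f.natDegree := by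
  set g := Submodule.IsPrincipal.generator Y.ideal with hg
  have hspan : Y.ideal = Ideal.span {g} := (Ideal.span_singleton_generator Y.ideal).symm
  have hF : geomPoly a b c N ∈ Y.ideal := Y.2.1.2 (Ideal.mem_span_singleton_self _)
  have hgF : g ∣ geomPoly a b c N := by
    rw [hspan] at hF
    exact Ideal.mem_span_singleton.1 hF
  have hg0 : g ≠ 0 := by
    intro h0
    rw [h0, zero_dvd_iff] at hgF
    exact (geomPoly_monic a b c N).ne_zero hgF
  have hprime : Prime g := (Ideal.span_singleton_prime hg0).1 (by rw [← hspan]; infer_instance)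
  obtain ⟨u, hu⟩ := (geomPoly_monic a b c N).isUnit_leadingCoeff_of_dvd hgF
  have hassoc : Associated g (C (↑u⁻¹ : (AlgebraicClosure K)[X]) * g) := by
    have hunit : IsUnit (C (↑u⁻¹ : (AlgebraicClosure K)[X])) := isUnit_C.2 u⁻¹.isUnit
    exact (associated_isUnit_mul_left_iff hunit).2 (Associated.refl g) |>.symm
  have hlc : (C (↑u⁻¹ : (AlgebraicClosure K)[X]) * g).Monic := by
    rw [Monic, leadingCoeff_mul, leadingCoeff_C, ← hu, Units.inv_mul]
  refine ⟨_, hlc, hassoc.irreducible hprime.irreducible, ?_, hassoc.dvd_iff_dvd_left.1 hgF, ?_⟩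
  · rw [hspan]
    exact Ideal.span_singleton_eq_span_singleton.2 hassoc
  · rw [degX, natDegree_C_mul (Units.ne_zero _)]

/-- A root of the equation of the component in the field of Laurent series identifies the ideal of
the component with the relations between the root and `t`. -/
def IsGenericRoot (Y : Component a b c N) (ρ : LaurentSeries (AlgebraicClosure K)) : Prop :=
  ∀ g, g ∈ Y.ideal ↔ evalAt ρ g = 0

theorem isGenericRoot_of_eval {Y : Component a b c N} {f : (AlgebraicClosure K)[X][X]}
    (hm : f.Monic) (hf : Irreducible f) (hY : Y.ideal = Ideal.span {f})
    {ρ : LaurentSeries (AlgebraicClosure K)} (hρ : evalAt ρ f = 0) : Y.IsGenericRoot ρ := by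
  intro g
  rw [hY, Ideal.mem_span_singleton]
  exact (eval₂_eq_zero_iff_dvd param_injective hf hm hρ g).symm

theorem IsGenericRoot.ideal_eq {Y Y' : Component a b c N}
    {ρ : LaurentSeries (AlgebraicClosure K)} (h : Y.IsGenericRoot ρ) (h' : Y'.IsGenericRoot ρ) :
    Y = Y' :=
  Subtype.ext (Ideal.ext fun g => (h g).trans (h' g).symm)

/-- Every root of the equation of `Y(N)` is a root of one of the components. -/
theorem exists_isGenericRoot {ρ : LaurentSeries (AlgebraicClosure K)}
    (hρ : evalAt ρ (geomPoly a b c N) = 0) : ∃ Y : Component a b c N, Y.IsGenericRoot ρ := by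
  have hF : geomPoly a b c N ∈ RingHom.ker (evalAt ρ) := hρ
  have hle : Ideal.span {geomPoly a b c N} ≤ RingHom.ker (evalAt ρ) := by
    rwa [Ideal.span_singleton_le_iff_mem]
  have : (RingHom.ker (evalAt ρ)).IsPrime := RingHom.ker_isPrime _
  obtain ⟨I, hI, hIle⟩ := Ideal.exists_minimalPrimes_le hle
  obtain ⟨f, hm, hf, hY, -, -⟩ := exists_monic (⟨I, hI⟩ : Component a b c N)
  refine ⟨⟨I, hI⟩, isGenericRoot_of_eval hm hf hY ?_⟩
  have hfI : f ∈ I := by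
    change I = _ at hY
    rw [hY]; exact Ideal.mem_span_singleton_self f
  exact hIle hfI

/-- The valuation ring is the one defined by the order of vanishing at a root in the field of
Laurent series. -/
structure Represents (Y : Component a b c N) (ρ : LaurentSeries (AlgebraicClosure K))
    (A : ValuationSubring Y.FunctionField) : Prop where
  isGenericRoot : Y.IsGenericRoot ρ
  mem_iff : ∀ g h, h ∉ Y.ideal → (Y.toFunctionField g / Y.toFunctionField h ∈ A ↔
    ordVal _ (evalAt ρ g) ≤ ordVal _ (evalAt ρ h))

theorem toFunctionField_eq_zero_iff (Y : Component a b c N) (g : (AlgebraicClosure K)[X][X]) :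
    Y.toFunctionField g = 0 ↔ g ∈ Y.ideal := by
  change algebraMap Y.CoordinateRing Y.FunctionField (Y.toCoordinateRing g) = 0 ↔ _
  rw [FaithfulSMul.algebraMap_eq_zero_iff]
  exact Ideal.Quotient.eq_zero_iff_mem

theorem exists_div (Y : Component a b c N) (z : Y.FunctionField) :
    ∃ g h, h ∉ Y.ideal ∧ z = Y.toFunctionField g / Y.toFunctionField h := by
  obtain ⟨p, q, hq, rfl⟩ := IsFractionRing.div_surjective (A := Y.CoordinateRing) z
  obtain ⟨g, rfl⟩ := Ideal.Quotient.mk_surjective p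
  obtain ⟨h, rfl⟩ := Ideal.Quotient.mk_surjective q
  refine ⟨g, h, fun hh => nonZeroDivisors.ne_zero hq (Ideal.Quotient.eq_zero_iff_mem.2 hh), rfl⟩

theorem IsGenericRoot.exists_represents {Y : Component a b c N}
    {ρ : LaurentSeries (AlgebraicClosure K)} (h : Y.IsGenericRoot ρ) :
    ∃ A, Y.Represents ρ A := by
  let φ : Y.CoordinateRing →+* LaurentSeries (AlgebraicClosure K) :=
    Ideal.Quotient.lift Y.ideal (evalAt ρ) fun g hg => (h g).1 hg
  have hφ : ∀ g, φ (Y.toCoordinateRing g) = evalAt ρ g := fun g => Ideal.Quotient.lift_mk ..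
  have hinj : Function.Injective φ := by
    rw [injective_iff_map_eq_zero]
    intro z hz
    obtain ⟨g, rfl⟩ := Ideal.Quotient.mk_surjective z
    exact Ideal.Quotient.eq_zero_iff_mem.2 ((h g).2 hz)
  let ψ : Y.FunctionField →+* LaurentSeries (AlgebraicClosure K) := IsFractionRing.lift hinj
  have hψ : ∀ g, ψ (Y.toFunctionField g) = evalAt ρ g := fun g => by
    rw [← hφ]
    exact IsFractionRing.lift_algebraMap hinj _
  refine ⟨(ordVal _).valuationSubring.comap ψ, h, fun g q hq => ?_⟩
  rw [ValuationSubring.mem_comap, Valuation.mem_valuationSubring_iff, map_div₀, hψ, hψ, map_div₀]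
  have hq0 : 0 < ordVal _ (evalAt ρ q) := zero_lt_iff.2
    ((Valuation.ne_zero_iff _).2 fun h0 => hq ((h q).2 h0))
  rw [div_le_one₀ hq0]

theorem Represents.unique {Y : Component a b c N} {ρ : LaurentSeries (AlgebraicClosure K)}
    {A A' : ValuationSubring Y.FunctionField} (h : Y.Represents ρ A) (h' : Y.Represents ρ A') :
    A = A' := by
  ext z
  obtain ⟨g, q, hq, rfl⟩ := Y.exists_div z
  rw [h.mem_iff g q hq, h'.mem_iff g q hq]

theorem one_notMem_ideal (Y : Component a b c N) : (1 : (AlgebraicClosure K)[X][X]) ∉ Y.ideal :=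
  fun h => (inferInstance : Y.ideal.IsPrime).ne_top ((Ideal.eq_top_iff_one _).2 h)

theorem Represents.mem_iff_le_one {Y : Component a b c N} {ρ : LaurentSeries (AlgebraicClosure K)}
    {A : ValuationSubring Y.FunctionField} (h : Y.Represents ρ A)
    (g : (AlgebraicClosure K)[X][X]) :
    Y.toFunctionField g ∈ A ↔ ordVal _ (evalAt ρ g) ≤ 1 := by
  have := h.mem_iff g 1 Y.one_notMem_ideal
  rwa [map_one, div_one, map_one, map_one] at this

theorem Represents.mem_pointsAtInfinity {Y : Component a b c N}
    {ρ : LaurentSeries (AlgebraicClosure K)} {A : ValuationSubring Y.FunctionField}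
    (h : Y.Represents ρ A) : A ∈ Y.pointsAtInfinity := by
  have ht : Y.toFunctionField (C X) ∉ A := by
    rw [h.mem_iff_le_one, not_le]
    simpa using one_lt_ordVal_param (p := (X : (AlgebraicClosure K)[X])) (by simp)
  refine ⟨⟨fun z => ?_, fun htop => ht (htop ▸ trivial)⟩, fun hn => ht (hn.2 _ ?_)⟩
  · rw [h.mem_iff_le_one]
    simp only [coe_eval₂RingHom, eval₂_C, param_C]
    by_cases hz : z = 0
    · simp [hz]
    · exact (ordVal_C hz).le
  · exact isIntegral_algebraMap

section Rational

variable {L : Type*} [Field L] [Algebra L (AlgebraicClosure K)]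

/-- The Laurent series is fixed by the automorphisms over `L`, acting on its coefficients. -/
def FixedBy (L : Type*) [Field L] [Algebra L (AlgebraicClosure K)]
    (ρ : LaurentSeries (AlgebraicClosure K)) : Prop :=
  ∀ σ : AlgebraicClosure K ≃ₐ[L] AlgebraicClosure K,
    mapCoeff (σ : AlgebraicClosure K →+* AlgebraicClosure K) ρ = ρ

theorem FixedBy.evalAt_conj {ρ : LaurentSeries (AlgebraicClosure K)} (h : FixedBy L ρ)
    (σ : AlgebraicClosure K ≃ₐ[L] AlgebraicClosure K) (g : (AlgebraicClosure K)[X][X]) :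
    evalAt ρ (conj σ g) = mapCoeff (σ : AlgebraicClosure K →+* AlgebraicClosure K)
      (evalAt ρ g) := by
  have : (evalAt ρ).comp (conj σ) =
      (mapCoeff (σ : AlgebraicClosure K →+* AlgebraicClosure K)).comp (evalAt ρ) := by
    apply Polynomial.ringHom_ext
    · intro p
      simp [conj, mapCoeff_param]
    · simp [conj, h σ]
  exact congrArg (fun f => f g) this

theorem FixedBy.ordVal_evalAt_conj {ρ : LaurentSeries (AlgebraicClosure K)} (h : FixedBy L ρ)
    (σ : AlgebraicClosure K ≃ₐ[L] AlgebraicClosure K) (g : (AlgebraicClosure K)[X][X]) :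
    ordVal _ (evalAt ρ (conj σ g)) = ordVal _ (evalAt ρ g) := by
  rw [h.evalAt_conj, ordVal_mapCoeff]

theorem IsGenericRoot.conj_mem_iff {Y : Component a b c N}
    {ρ : LaurentSeries (AlgebraicClosure K)} (hρ : Y.IsGenericRoot ρ) (h : FixedBy L ρ)
    (σ : AlgebraicClosure K ≃ₐ[L] AlgebraicClosure K) (g : (AlgebraicClosure K)[X][X]) :
    conj σ g ∈ Y.ideal ↔ g ∈ Y.ideal := by
  rw [hρ, hρ, h.evalAt_conj, map_eq_zero]

theorem conj_conj_symm (σ : AlgebraicClosure K ≃ₐ[L] AlgebraicClosure K)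
    (g : (AlgebraicClosure K)[X][X]) : conj σ (conj σ.symm g) = g := by
  ext i j
  simp [conj]

theorem Represents.isRational {Y : Component a b c N} {ρ : LaurentSeries (AlgebraicClosure K)}
    {A : ValuationSubring Y.FunctionField} (hρ : Y.Represents ρ A) (h : FixedBy L ρ) :
    Y.IsRational L A := by
  intro σ
  refine ⟨le_antisymm ?_ fun g hg => ?_, fun g q hq => ?_⟩
  · rw [Ideal.map_le_iff_le_comap]
    intro g hg
    exact (hρ.isGenericRoot.conj_mem_iff h σ g).2 hg
  · rw [← conj_conj_symm σ g]
    exact Ideal.mem_map_of_mem _ ((hρ.isGenericRoot.conj_mem_iff h σ.symm g).2 hg)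
  · rw [hρ.mem_iff g q hq, hρ.mem_iff _ _ (mt (hρ.isGenericRoot.conj_mem_iff h σ q).1 hq),
      h.ordVal_evalAt_conj, h.ordVal_evalAt_conj]

/-- The monic equation of the component is determined by the root, hence has Galois-invariant
coefficients. -/
theorem IsGenericRoot.isDefinedOver [IsGalois L (AlgebraicClosure K)] {Y : Component a b c N}
    {ρ : LaurentSeries (AlgebraicClosure K)} (hρ : Y.IsGenericRoot ρ) (h : FixedBy L ρ) :
    Y.IsDefinedOver L := by
  obtain ⟨f, hm, hf, hY, -, -⟩ := Y.exists_monic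
  have hfix : ∀ σ : AlgebraicClosure K ≃ₐ[L] AlgebraicClosure K, conj σ f = f := by
    intro σ
    have hmem : conj σ f ∈ Y.ideal :=
      (hρ.conj_mem_iff h σ f).2 (by rw [hY]; exact Ideal.mem_span_singleton_self f)
    rw [hY, Ideal.mem_span_singleton] at hmem
    refine (eq_of_monic_of_dvd_of_natDegree_le hm (hm.map _) hmem ?_)
    exact natDegree_map_le
  have hcoef : ∀ i j, (f.coeff i).coeff j ∈ Set.range (algebraMap L (AlgebraicClosure K)) := by
    intro i j
    rw [InfiniteGalois.mem_range_algebraMap_iff_fixed]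
    intro σ
    have := congrArg (fun p => (Polynomial.coeff p i).coeff j) (hfix σ)
    simpa [conj] using this
  have hlift : f ∈ Polynomial.lifts (mapRingHom (algebraMap L (AlgebraicClosure K))) := by
    rw [Polynomial.lifts_iff_coeff_lifts]
    intro i
    have : f.coeff i ∈ Polynomial.lifts (algebraMap L (AlgebraicClosure K)) := by
      rw [Polynomial.lifts_iff_coeff_lifts]
      exact hcoef i
    obtain ⟨p, hp⟩ := (Polynomial.mem_lifts _).1 this
    exact ⟨p, hp⟩
  obtain ⟨q, hq⟩ := (Polynomial.mem_lifts _).1 hlift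
  refine ⟨Ideal.span {q}, ?_⟩
  rw [Ideal.map_span, Set.image_singleton, coe_mapRingHom, hq, hY]

end Rational

/-- Roots of a component with the same valuation ring are equal up to `s ↦ -s`: a polynomial in `x`
over `k[t]` approximating a multiple of `(x - ρ₁) (x - ρ₁(-s))` is small at `ρ₁`, hence at `ρ₂`. -/
theorem Represents.eq_or_eq_flip [CharZero K] {Y : Component a b c N}
    {ρ₁ ρ₂ : LaurentSeries (AlgebraicClosure K)} {A : ValuationSubring Y.FunctionField}
    (h₁ : Y.Represents ρ₁ A) (h₂ : Y.Represents ρ₂ A) : ρ₂ = ρ₁ ∨ ρ₂ = flip ρ₁ := by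
  set v := ordVal (AlgebraicClosure K)
  set T := param (X : (AlgebraicClosure K)[X]) with hT
  by_contra hcon
  push Not at hcon
  set w := (ρ₂ - ρ₁) * (ρ₂ - flip ρ₁) with hw
  have hw0 : w ≠ 0 := mul_ne_zero (sub_ne_zero.2 hcon.1) (sub_ne_zero.2 hcon.2)
  obtain ⟨n₁, hn₁⟩ := exists_le_ordVal_pow ρ₁
  obtain ⟨n₂, hn₂⟩ := exists_le_ordVal_pow ρ₂
  obtain ⟨m, hm⟩ := exists_le_ordVal_pow w⁻¹
  set n := max n₁ n₂
  replace hn₁ := hn₁ n (le_max_left _ _)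
  replace hn₂ := hn₂ n (le_max_right _ _)
  replace hm := hm m le_rfl
  have hT1 : 1 < v T := one_lt_ordVal_param (by simp)
  have hTn : ∀ i : ℕ, param (X ^ i : (AlgebraicClosure K)[X]) = T ^ i := fun i => map_pow _ _ _
  rw [hTn] at hn₁ hn₂ hm
  have hn0 : 1 ≤ v (T ^ n) := by rw [map_pow]; exact one_le_pow₀ hT1.le
  set M := n + 1 + m
  -- approximate the sum and the product of the conjugates `ρ₁` and `flip ρ₁`
  have hflip : ∀ z, flip z = z → flip (T ^ M * z) = T ^ M * z := fun z hz => by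
    rw [map_mul, map_pow, hz, hT, flip_param]
  obtain ⟨p, hp⟩ := exists_param_sub_lt_one (k := AlgebraicClosure K) (hflip (ρ₁ + flip ρ₁)
    (by rw [map_add, flip_flip, add_comm]))
  obtain ⟨q, hq⟩ := exists_param_sub_lt_one (k := AlgebraicClosure K) (hflip (ρ₁ * flip ρ₁)
    (by rw [map_mul, flip_flip, mul_comm]))
  set g : (AlgebraicClosure K)[X][X] := C (X ^ M) * X ^ 2 - C p * X + C q with hg
  have hev : ∀ ρ, evalAt ρ g = T ^ M * ((ρ - ρ₁) * (ρ - flip ρ₁)) +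
      ((T ^ M * (ρ₁ + flip ρ₁) - param p) * ρ - (T ^ M * (ρ₁ * flip ρ₁) - param q)) := by
    intro ρ
    simp only [hg, map_add, map_sub, map_mul, map_pow, coe_eval₂RingHom, eval₂_C, eval₂_X]
    ring
  have hsmall : ∀ ρ, v ρ ≤ v (T ^ n) → v ((T ^ M * (ρ₁ + flip ρ₁) - param p) * ρ -
      (T ^ M * (ρ₁ * flip ρ₁) - param q)) ≤ v (T ^ n) := by
    intro ρ hρ
    refine (v.map_sub _ _).trans (max_le ?_ (hq.le.trans hn0))
    rw [map_mul]
    exact (mul_le_of_le_one_left zero_le hp.le).trans hρ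
  have hTni : (C (X ^ n) : (AlgebraicClosure K)[X][X]) ∉ Y.ideal := by
    rw [h₁.isGenericRoot]
    simp only [coe_eval₂RingHom, eval₂_C, hTn]
    intro h0
    rw [h0, map_zero] at hn0
    exact absurd hn0 (not_le.2 zero_lt_one)
  have hevT : ∀ ρ, evalAt ρ (C (X ^ n) : (AlgebraicClosure K)[X][X]) = T ^ n := fun ρ => by
    simp only [coe_eval₂RingHom, eval₂_C, hTn]
  have hA : Y.toFunctionField g / Y.toFunctionField (C (X ^ n)) ∈ A := by
    rw [h₁.mem_iff _ _ hTni, hev, hevT, sub_self, zero_mul, mul_zero, zero_add]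
    exact hsmall _ hn₁
  rw [h₂.mem_iff _ _ hTni, hevT] at hA
  have hle : v (T ^ M * w) ≤ v (T ^ n) := by
    have : T ^ M * w = evalAt ρ₂ g - ((T ^ M * (ρ₁ + flip ρ₁) - param p) * ρ₂ -
      (T ^ M * (ρ₁ * flip ρ₁) - param q)) := by rw [hev]; ring
    rw [this]
    exact (v.map_sub _ _).trans (max_le hA (hsmall _ hn₂))
  have hge : 1 ≤ v (T ^ m * w) := by
    rw [map_mul]
    have : v w⁻¹ * v w ≤ v (T ^ m) * v w := by gcongr
    rwa [← map_mul, inv_mul_cancel₀ hw0, map_one] at this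
  have hlt : v (T ^ n) < v (T ^ (n + 1)) := by
    rw [map_pow, map_pow]
    exact pow_lt_pow_right₀ hT1 (Nat.lt_succ_self n)
  have : v (T ^ (n + 1)) ≤ v (T ^ M * w) := by
    have e : T ^ M * w = T ^ (n + 1) * (T ^ m * w) := by
      rw [show M = n + 1 + m from rfl, pow_add, mul_assoc]
    rw [e, map_mul]
    exact le_mul_of_one_le_right zero_le hge
  exact absurd (this.trans hle) (not_le.2 hlt)

end Component

end Component

/-! ### The number of points at infinity -/

/-- In a finite separable extension `F` of the fraction field of a principal ideal domain `R`, the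
valuation rings centred at a maximal ideal of `R` are no more than the degree of the extension. -/
theorem ncard_valuationSubring_le_finrank (R K₀ F : Type*) [CommRing R] [IsDomain R]
    [IsPrincipalIdealRing R] [Field K₀] [Algebra R K₀] [IsFractionRing R K₀] [Field F]
    [Algebra K₀ F] [Algebra R F] [IsScalarTower R K₀ F] [FiniteDimensional K₀ F]
    [Algebra.IsSeparable K₀ F] (p : Ideal R) [p.IsMaximal] (hp : p ≠ ⊥) :
    {A : ValuationSubring F | (∀ r, algebraMap R F r ∈ A) ∧
      ∀ r ∈ p, A.valuation (algebraMap R F r) < 1}.Finite ∧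
    {A : ValuationSubring F | (∀ r, algebraMap R F r ∈ A) ∧
      ∀ r ∈ p, A.valuation (algebraMap R F r) < 1}.ncard ≤ Module.finrank K₀ F := by
  classical
  let S := integralClosure R F
  have : IsDedekindDomain S := integralClosure.isDedekindDomain R K₀ F
  have : IsFractionRing S F := integralClosure.isFractionRing_of_finite_extension K₀ F
  have : Module.Finite R S := IsIntegralClosure.finite R K₀ F S
  have : FaithfulSMul R F := by
    rw [faithfulSMul_iff_algebraMap_injective, IsScalarTower.algebraMap_eq R K₀ F]
    exact (algebraMap K₀ F).injective.comp (IsFractionRing.injective R K₀)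
  have hRS : Function.Injective (algebraMap R S) := by
    have : Function.Injective ((algebraMap S F).comp (algebraMap R S)) := by
      rw [← IsScalarTower.algebraMap_eq]
      exact FaithfulSMul.algebraMap_injective R F
    rw [RingHom.coe_comp] at this
    exact this.of_comp
  have : FaithfulSMul R S := (faithfulSMul_iff_algebraMap_injective _ _).2 hRS
  have : Module.IsTorsionFree R S := inferInstance
  have hfin : (p.primesOver S).Finite := IsDedekindDomain.primesOver_finite p S
  have : Fintype (p.primesOver S) := hfin.fintype
  have hcard : (p.primesOver S).ncard ≤ Module.finrank K₀ F := by
    rw [← IsIntegralClosure.rank R K₀ F S, ← Ideal.sum_ramification_inertia_eq_finrank p S,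
      ← Nat.card_coe_set_eq, Nat.card_eq_fintype_card, Fintype.card_eq_sum_ones]
    refine Finset.sum_le_sum fun q _ => ?_
    have := q.2.1
    exact Nat.mul_pos (q.1.ramificationIdx_pos R) (q.1.inertiaDeg_pos R)
  -- such a valuation ring is the localization of `S` at its centre
  let g : Ideal S → ValuationSubring F := fun q =>
    if h : q.IsPrime ∧ q ≠ ⊥ then
      ((⟨q, h.1, h.2⟩ : IsDedekindDomain.HeightOneSpectrum S).valuation F).valuationSubring
    else ⊤
  have hsub : {A : ValuationSubring F | (∀ r, algebraMap R F r ∈ A) ∧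
      ∀ r ∈ p, A.valuation (algebraMap R F r) < 1} ⊆ g '' p.primesOver S := by
    rintro A ⟨hA, hpA⟩
    have hSA : ∀ z : S, algebraMap S F z ∈ A := by
      intro z
      have hz : IsIntegral A (algebraMap S F z) := by
        obtain ⟨f, hf, hfz⟩ := z.2
        let i : R →+* A := (algebraMap R F).codRestrict A.toSubring hA
        refine ⟨f.map i, hf.map i, ?_⟩
        rw [eval₂_map]
        exact hfz
      obtain ⟨w, hw⟩ := IsIntegrallyClosed.isIntegral_iff.1 hz
      rw [← hw]
      exact w.2
    let i : S →+* A := (algebraMap S F).codRestrict A.toSubring hSA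
    let q : Ideal S := (IsLocalRing.maximalIdeal A).comap i
    have hq : ∀ z, z ∈ q ↔ A.valuation (algebraMap S F z) < 1 := fun z =>
      A.valuation_lt_one_iff (i z)
    have hqp : q.IsPrime := Ideal.comap_isPrime _ _
    have hover : q.LiesOver p := by
      constructor
      refine Ideal.IsMaximal.eq_of_le inferInstance
        (Ideal.IsPrime.ne_top (Ideal.IsPrime.under R q)) fun r hr => ?_
      rw [Ideal.under_def, Ideal.mem_comap, hq, ← IsScalarTower.algebraMap_apply]
      exact hpA r hr
    have hq0 : q ≠ ⊥ := Ideal.ne_bot_of_liesOver_of_ne_bot hp q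
    refine ⟨q, ⟨hqp, hover⟩, ?_⟩
    simp only [g]
    rw [dif_pos ⟨hqp, hq0⟩]
    refine ValuationSubring.eq_of_le_of_ne_top _ (fun z hz => ?_) ?_
    · rw [Valuation.mem_valuationSubring_iff] at hz
      obtain ⟨n, d, hd⟩ :=
        IsDedekindDomain.HeightOneSpectrum.exists_primeCompl_mul_eq_of_integer _ z hz
      have hd1 : A.valuation (algebraMap S F d) = 1 := by
        have h1 : ¬ A.valuation (algebraMap S F d) < 1 := fun h => d.2 ((hq _).2 h)
        exact le_antisymm ((A.valuation_le_one_iff _).2 (hSA _)) (not_lt.1 h1)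
      rw [← A.valuation_le_one_iff]
      have h2 := (A.valuation_le_one_iff _).2 (hSA n)
      rwa [← hd, map_mul, hd1, mul_one] at h2
    · intro htop
      obtain ⟨z, hz, hz0⟩ := Submodule.exists_mem_ne_zero_of_ne_bot hq0
      have h1 := (hq z).1 hz
      have h0 : A.valuation (algebraMap S F z) ≠ 0 := by
        rw [Valuation.ne_zero_iff]
        exact fun h => hz0 ((FaithfulSMul.algebraMap_eq_zero_iff S F).1 h)
      have h3 : (algebraMap S F z)⁻¹ ∈ A := htop ▸ ValuationSubring.mem_top _
      rw [← A.valuation_le_one_iff, map_inv₀, inv_le_one₀ (zero_lt_iff.2 h0)] at h3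
      exact absurd h1 (not_lt.2 h3)
  exact ⟨(hfin.image g).subset hsub, (Set.ncard_le_ncard hsub (hfin.image g)).trans
    ((Set.ncard_image_le hfin).trans hcard)⟩

/-- A curve given by a monic equation of degree `d` over the `t`-line has at most `d` points over
`t = ∞`. -/
theorem ncard_valuationSubring_le_natDegree {k F : Type*} [Field k] [CharZero k] [Field F]
    {j : k[X] →+* F} (hj : Function.Injective j) {f : k[X][X]} (hf : f.Monic) {x : F}
    (hx : f.eval₂ j x = 0) (hgen : ∀ z, ∃ g h : k[X][X], z = g.eval₂ j x / h.eval₂ j x) :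
    {A : ValuationSubring F | (∀ r, j (C r) ∈ A) ∧ j X ∉ A}.Finite ∧
    {A : ValuationSubring F | (∀ r, j (C r) ∈ A) ∧ j X ∉ A}.ncard ≤ f.natDegree := by
  have hX0 : j X ≠ 0 := (map_ne_zero_iff j hj).2 X_ne_zero
  -- the coordinate at infinity
  let θ : k[X] →+* F := eval₂RingHom (j.comp C) (j X)⁻¹
  have hθ : Function.Injective θ := by
    rw [injective_iff_map_eq_zero]
    intro p hp
    let _ := invertibleOfNonzero (inv_ne_zero hX0)
    have h3 := eval₂_reverse_eq_zero_iff (j.comp C) (j X)⁻¹ p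
    rw [invOf_eq_inv, inv_inv] at h3
    have h4 : j p.reverse = 0 := by
      rw [← h3.2 hp]
      conv_lhs => rw [← eval₂_C_X (p := p.reverse), hom_eval₂]
    rw [map_eq_zero_iff j hj, reverse_eq_zero] at h4
    exact h4
  let _ : Algebra k[X] F := θ.toAlgebra
  let K₀ := FractionRing k[X]
  let _ : Algebra K₀ F := (IsFractionRing.lift hθ).toAlgebra
  have : IsScalarTower k[X] K₀ F := IsScalarTower.of_algebraMap_eq fun p =>
    (IsFractionRing.lift_algebraMap hθ p).symm
  have hθX : algebraMap k[X] F X = (j X)⁻¹ := by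
    change θ X = _
    simp [θ]
  have hθC : ∀ r, algebraMap k[X] F (C r) = j (C r) := fun r => by
    change θ (C r) = _
    simp [θ]
  let κ : k[X] →+* K₀ := eval₂RingHom ((algebraMap k[X] K₀).comp C) (algebraMap k[X] K₀ X)⁻¹
  have hκ : (algebraMap K₀ F).comp κ = j := by
    apply Polynomial.ringHom_ext
    · intro r
      simp only [κ, RingHom.comp_apply, coe_eval₂RingHom, eval₂_C]
      rw [← IsScalarTower.algebraMap_apply, hθC]
    · simp only [κ, RingHom.comp_apply, coe_eval₂RingHom, eval₂_X, map_inv₀]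
      rw [← IsScalarTower.algebraMap_apply, hθX, inv_inv]
  have heval : ∀ g : k[X][X], g.eval₂ j x = aeval x (g.map κ) := fun g => by
    rw [aeval_def, eval₂_map, hκ]
  have hx0 : aeval x (f.map κ) = 0 := by rw [← heval, hx]
  have hint : IsIntegral K₀ x := ⟨f.map κ, hf.map κ, hx0⟩
  have htop : IntermediateField.adjoin K₀ {x} = ⊤ := by
    rw [eq_top_iff]
    rintro z -
    obtain ⟨g, h, rfl⟩ := hgen z
    have hmem : ∀ g : k[X][X], g.eval₂ j x ∈ IntermediateField.adjoin K₀ {x} := fun g => by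
      rw [heval]
      exact IntermediateField.algebra_adjoin_le_adjoin _ _ (aeval_mem_adjoin_singleton _ _)
    exact div_mem (hmem g) (hmem h)
  have : FiniteDimensional K₀ F := by
    have := IntermediateField.adjoin.finiteDimensional hint
    rw [htop] at this
    exact IntermediateField.topEquiv.toLinearEquiv.finiteDimensional
  have hrank : Module.finrank K₀ F ≤ f.natDegree := by
    rw [← IntermediateField.finrank_top', ← htop, IntermediateField.adjoin.finrank hint]
    have := natDegree_le_of_dvd (minpoly.dvd K₀ x hx0) (hf.map κ).ne_zero
    rwa [hf.natDegree_map] at this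
  have hmax : (Ideal.span {(X : k[X])}).IsMaximal :=
    PrincipalIdealRing.isMaximal_of_irreducible irreducible_X
  have hbot : Ideal.span {(X : k[X])} ≠ ⊥ := by
    rw [Ne, Ideal.span_singleton_eq_bot]; exact X_ne_zero
  have : CharZero K₀ := charZero_of_injective_algebraMap (IsFractionRing.injective k[X] K₀) 
  obtain ⟨hfin, hcard⟩ := ncard_valuationSubring_le_finrank k[X] K₀ F (Ideal.span {X}) hbot
  have hsub : {A : ValuationSubring F | (∀ r, j (C r) ∈ A) ∧ j X ∉ A} ⊆
      {A : ValuationSubring F | (∀ r, algebraMap k[X] F r ∈ A) ∧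
        ∀ r ∈ Ideal.span {(X : k[X])}, A.valuation (algebraMap k[X] F r) < 1} := by
    rintro A ⟨hC, hX⟩
    have hlt : A.valuation (j X)⁻¹ < 1 := by
      rw [← A.valuation_le_one_iff, not_le] at hX
      rw [map_inv₀]
      exact inv_lt_one_of_one_lt₀ hX
    have hmem : ∀ r, algebraMap k[X] F r ∈ A := by
      intro r
      induction r using Polynomial.induction_on' with
      | add p q hp hq => rw [map_add]; exact add_mem hp hq
      | monomial n r =>
        rw [← C_mul_X_pow_eq_monomial, map_mul, map_pow, hθX, hθC]
        exact mul_mem (hC r) (pow_mem ((A.valuation_le_one_iff _).1 hlt.le) n)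
    refine ⟨hmem, fun r hr => ?_⟩
    obtain ⟨s, rfl⟩ := Ideal.mem_span_singleton.1 hr
    rw [map_mul, map_mul, hθX]
    exact mul_lt_one_of_lt_of_le hlt ((A.valuation_le_one_iff _).2 (hmem s))
  exact ⟨hfin.subset hsub, (Set.ncard_le_ncard hsub hfin).trans (hcard.trans hrank)⟩

namespace Component

variable {K : Type*} [Field K] [CharZero K] {a b c : K[X]} {N : ℕ}

/-- A point of the complete curve where `t` is regular lies on the normalization, since the coordinate
ring is integral over `k[t]`. -/
theorem finite_pointsAtInfinity_and_ncard_le (Y : Component a b c N) :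
    Y.pointsAtInfinity.Finite ∧ Y.pointsAtInfinity.ncard ≤ Y.degX := by
  obtain ⟨f, hm, hf, hY, -, hdeg⟩ := Y.exists_monic
  let j : (AlgebraicClosure K)[X] →+* Y.FunctionField := Y.toFunctionField.comp C
  have hj : Function.Injective j := by
    rw [injective_iff_map_eq_zero]
    intro p hp
    have hp' : C p ∈ Y.ideal := (Y.toFunctionField_eq_zero_iff _).1 hp
    rw [hY, Ideal.mem_span_singleton] at hp'
    by_contra hp0
    have hd := natDegree_le_of_dvd hp' (C_ne_zero.2 hp0)
    rw [natDegree_C, Nat.le_zero, hm.natDegree_eq_zero] at hd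
    exact hf.not_isUnit (hd ▸ isUnit_one)
  have heval : ∀ g, Y.toFunctionField g = g.eval₂ j (Y.toFunctionField X) := by
    intro g
    have : Y.toFunctionField = eval₂RingHom j (Y.toFunctionField X) := by
      apply Polynomial.ringHom_ext
      · intro p; simp [j]
      · simp
    exact congrArg (fun φ => φ g) this
  have hx : f.eval₂ j (Y.toFunctionField X) = 0 := by
    rw [← heval, Y.toFunctionField_eq_zero_iff, hY]
    exact Ideal.mem_span_singleton_self f
  have hgen : ∀ z, ∃ g h : (AlgebraicClosure K)[X][X],
      z = g.eval₂ j (Y.toFunctionField X) / h.eval₂ j (Y.toFunctionField X) := by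
    intro z
    obtain ⟨g, h, -, rfl⟩ := Y.exists_div z
    exact ⟨g, h, by rw [← heval, ← heval]⟩
  obtain ⟨hfin, hcard⟩ := ncard_valuationSubring_le_natDegree hj hm hx hgen
  have hsub : Y.pointsAtInfinity ⊆ {A | (∀ r, j (C r) ∈ A) ∧ j X ∉ A} := by
    rintro A ⟨hA, hn⟩
    refine ⟨hA.1, fun hX => hn ⟨hA, fun z hz => ?_⟩⟩
    -- `A` contains `k[t]`, over which the coordinate ring is integral
    have hjA : ∀ p, j p ∈ A := by
      intro p
      induction p using Polynomial.induction_on' with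
      | add p q hp hq => rw [map_add]; exact add_mem hp hq
      | monomial n r =>
        rw [← C_mul_X_pow_eq_monomial, map_mul, map_pow]
        exact mul_mem (hA.1 r) (pow_mem hX n)
    have hint : ∀ w : Y.FunctionField, IsIntegral A w → w ∈ A := by
      intro w hw
      obtain ⟨w', rfl⟩ := IsIntegrallyClosed.isIntegral_iff.1 hw
      exact w'.2
    have hxA : Y.toFunctionField X ∈ A := by
      apply hint
      let i : (AlgebraicClosure K)[X] →+* A := j.codRestrict A.toSubring hjA
      refine ⟨f.map i, hm.map i, ?_⟩
      rw [eval₂_map]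
      exact hx
    have hcoord : ∀ w : Y.CoordinateRing, algebraMap _ Y.FunctionField w ∈ A := by
      intro w
      obtain ⟨g, rfl⟩ := Ideal.Quotient.mk_surjective w
      change Y.toFunctionField g ∈ A
      rw [heval, eval₂_eq_sum_range]
      exact sum_mem fun i _ => mul_mem (hjA _) (pow_mem hxA i)
    apply hint
    obtain ⟨q, hq, hqz⟩ := hz
    let i : Y.CoordinateRing →+* A := (algebraMap _ Y.FunctionField).codRestrict A.toSubring hcoord
    refine ⟨q.map i, hq.map i, ?_⟩
    rw [eval₂_map]
    exact hqz
  exact ⟨hfin.subset hsub, (Set.ncard_le_ncard hsub hfin).trans (hcard.trans hdeg.ge)⟩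

end Component

/-! ### Quadratic extensions of number fields and counting of rational points -/

theorem exists_not_isSquare (K : Type*) [Field K] [NumberField K] : ∃ d : K, ¬ IsSquare d := by
  by_contra hcon
  push Not at hcon
  -- otherwise `K` contains roots of unity of all orders `2 ^ (n + 1)`
  have hroot : ∀ n : ℕ, ∃ z : K, z ^ 2 ^ n = -1 := by
    intro n
    induction n with
    | zero => exact ⟨-1, by simp⟩
    | succ n ih =>
      obtain ⟨z, hz⟩ := ih
      obtain ⟨y, hy⟩ := hcon z
      refine ⟨y, ?_⟩
      rw [← hz, hy, pow_succ', pow_mul, sq]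
  obtain ⟨z, hz⟩ := hroot (Module.finrank ℚ K)
  set n := Module.finrank ℚ K
  have hord : orderOf z = 2 ^ (n + 1) := by
    have : Fact (Nat.Prime 2) := ⟨Nat.prime_two⟩
    apply orderOf_eq_prime_pow
    · rw [hz]; norm_num
    · rw [pow_succ, pow_mul, hz]; norm_num
  have hprim : IsPrimitiveRoot z (2 ^ (n + 1)) := hord ▸ IsPrimitiveRoot.orderOf z
  have h2 := cyclotomic_eq_minpoly_rat hprim (by positivity)
  have h3 : (minpoly ℚ z).natDegree ≤ n := minpoly.natDegree_le z
  rw [← h2, natDegree_cyclotomic, Nat.totient_prime_pow_succ Nat.prime_two] at h3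
  simp only [Nat.add_one_sub_one, mul_one] at h3
  exact absurd h3 (not_le.2 n.lt_two_pow_self)

theorem finrank_adjoin_sqrt {K L : Type*} [Field K] [Field L] [Algebra K L] {z : L}
    (hz : z ∉ Set.range (algebraMap K L)) (hz2 : z ^ 2 ∈ Set.range (algebraMap K L)) :
    Module.finrank K (IntermediateField.adjoin K {z}) = 2 := by
  obtain ⟨d, hd⟩ := hz2
  have hroot : aeval z (X ^ 2 - C d : K[X]) = 0 := by simp [hd]
  have hmonic : (X ^ 2 - C d : K[X]).Monic := monic_X_pow_sub_C d two_ne_zero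
  have hint : IsIntegral K z := ⟨_, hmonic, hroot⟩
  rw [IntermediateField.adjoin.finrank hint]
  apply le_antisymm
  · have := natDegree_le_of_dvd (minpoly.dvd K z hroot) hmonic.ne_zero
    rwa [natDegree_X_pow_sub_C] at this
  · exact (minpoly.two_le_natDegree_iff hint).2 hz

theorem exists_quadratic {K : Type*} [Field K] [NumberField K] {z : AlgebraicClosure K}
    (hz : z ^ 2 ∈ Set.range (algebraMap K (AlgebraicClosure K))) :
    ∃ K' : IntermediateField K (AlgebraicClosure K), Module.finrank K K' = 2 ∧ z ∈ K' := by
  by_cases hzK : z ∈ Set.range (algebraMap K (AlgebraicClosure K))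
  · obtain ⟨d, hd⟩ := exists_not_isSquare K
    obtain ⟨y, hy⟩ := IsAlgClosed.exists_pow_nat_eq (algebraMap K (AlgebraicClosure K) d)
      (n := 2) two_pos
    refine ⟨IntermediateField.adjoin K {y}, finrank_adjoin_sqrt ?_ ⟨d, hy.symm⟩, ?_⟩
    · rintro ⟨e, rfl⟩
      rw [← map_pow] at hy
      exact hd ⟨e, by rw [← (algebraMap K (AlgebraicClosure K)).injective hy, sq]⟩
    · obtain ⟨e, rfl⟩ := hzK
      exact IntermediateField.algebraMap_mem _ e
  · exact ⟨IntermediateField.adjoin K {z}, finrank_adjoin_sqrt hzK hz,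
      IntermediateField.mem_adjoin_simple_self K z⟩

section Count

variable {K : Type*} [Field K] {a b c : K[X]} {N : ℕ}

namespace Component

theorem flip_eq_of_mem {r : LaurentSeries (AlgebraicClosure K)}
    (hr : r ∈ rationalClosure (ordVal (AlgebraicClosure K)) {series b, series c, series a}) :
    flip r = r :=
  hr flip ordVal_flip (by simp [flip_param])

theorem fixedBy_of_mem {L : Type*} [Field L] [Algebra L (AlgebraicClosure K)]
    {S : Set (LaurentSeries (AlgebraicClosure K))}
    (hS : ∀ s ∈ S, FixedBy L s) {r : LaurentSeries (AlgebraicClosure K)}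
    (hr : r ∈ rationalClosure (ordVal (AlgebraicClosure K)) S) : FixedBy L r :=
  fun σ => hr (mapCoeff (σ : AlgebraicClosure K →+* AlgebraicClosure K)) (ordVal_mapCoeff _)
    fun s hs => hS s hs σ

section Fixed

variable {L : Type*} [Field L] [Algebra L (AlgebraicClosure K)] [Algebra K L]
  [IsScalarTower K L (AlgebraicClosure K)]

theorem fixedBy_series (L : Type*) [Field L] [Algebra L (AlgebraicClosure K)] [Algebra K L]
    [IsScalarTower K L (AlgebraicClosure K)] (p : K[X]) : FixedBy L (series p) := by
  intro σ
  rw [mapCoeff_param, Polynomial.map_map]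
  congr 2
  ext r
  change σ (algebraMap K (AlgebraicClosure K) r) = _
  rw [IsScalarTower.algebraMap_apply K L (AlgebraicClosure K), AlgEquiv.commutes]

theorem fixedBy_of_mem_series {r : LaurentSeries (AlgebraicClosure K)}
    (hr : r ∈ rationalClosure (ordVal (AlgebraicClosure K)) {series b, series c, series a}) :
    FixedBy L r :=
  fixedBy_of_mem (by
    rintro s (rfl | rfl | rfl)
    exacts [fixedBy_series L b, fixedBy_series L c, fixedBy_series L a]) hr

end Fixed

theorem sq_leadingCoeff_mem_range [CharZero K] {w : LaurentSeries (AlgebraicClosure K)}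
    (hw : FixedBy K (w ^ 2)) :
    w.leadingCoeff ^ 2 ∈ Set.range (algebraMap K (AlgebraicClosure K)) := by
  rw [InfiniteGalois.mem_range_algebraMap_iff_fixed]
  intro σ
  have h := congrArg (fun z => HahnSeries.coeff z (w.order + w.order)) (hw σ)
  simp only [coeff_mapCoeff, sq, HahnSeries.coeff_mul_order_add_order] at h
  rw [sq]
  exact h

/-- An automorphism sends `w` to `w` or `-w`, and the leading coefficient tells which. -/
theorem fixedBy_of_sq [CharZero K] {K' : IntermediateField K (AlgebraicClosure K)}
    {w : LaurentSeries (AlgebraicClosure K)} (hw0 : w ≠ 0) (hw : FixedBy K' (w ^ 2))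
    (hmem : w.leadingCoeff ∈ K') : FixedBy K' w := by
  intro σ
  have h := hw σ
  rw [map_pow, sq_eq_sq_iff_eq_or_eq_neg] at h
  refine h.resolve_right fun hneg => ?_
  have hlc := congrArg (fun z => HahnSeries.coeff z w.order) hneg
  simp only [coeff_mapCoeff, HahnSeries.coeff_neg, ← HahnSeries.leadingCoeff_eq] at hlc
  have hσ : σ w.leadingCoeff = w.leadingCoeff := σ.commutes (⟨_, hmem⟩ : K')
  have h0 : w.leadingCoeff = -w.leadingCoeff := hσ.symm.trans hlc
  exact hw0 (HahnSeries.leadingCoeff_eq_zero.1 (self_eq_neg.1 h0))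

end Component

open Component

/-- The roots of the equation of `Y(N)` are fixed by the automorphisms over some quadratic extension
of `K`, the one containing the leading coefficient of the square root `w` of `QuadraticRoots`.
They are at least `2 ^ N` in number, or at least `2 ^ (N - 1)` and then all series in `t⁻¹`. -/
theorem exists_quadratic_fixedBy [NumberField K] (hb : 0 < b.natDegree) (hc : 0 < c.natDegree) :
    ((geomPoly a b c N).map param).Splits ∧
    ∃ K' : IntermediateField K (AlgebraicClosure K), Module.finrank K K' = 2 ∧
      (∀ r ∈ ((geomPoly a b c N).map param).roots, FixedBy K' r) ∧
      (¬ (2 ≤ N ∧ a = -1 ∧ b + c = 2) → ∃ s : Finset (LaurentSeries (AlgebraicClosure K)),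
        (∀ r ∈ s, ((geomPoly a b c N).map param).IsRoot r) ∧
        (2 ^ N ≤ s.card ∨ 2 ^ (N - 1) ≤ s.card ∧ ∀ r ∈ s, flip r = r)) := by
  rw [geomPoly_map_param]
  have hF := fiberPoly_monic (series b) (series c) N (series a)
  set i := algebraMap K (AlgebraicClosure K)
  have hb' : 0 < (b.map i).natDegree := by rwa [natDegree_map]
  have hc' : 0 < (c.map i).natDegree := by rwa [natDegree_map]
  have hdefault : ∃ K' : IntermediateField K (AlgebraicClosure K), Module.finrank K K' = 2 := by
    obtain ⟨K', hK', -⟩ := exists_quadratic (K := K) (z := 0) ⟨0, by simp⟩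
    exact ⟨K', hK'⟩
  by_cases hexc : 2 ≤ N ∧ a = -1 ∧ b + c = 2
  · obtain ⟨hN, rfl, hbc⟩ := hexc
    obtain ⟨K', hK'⟩ := hdefault
    have hbc' : series b + series c = 2 := by
      rw [← map_add, ← Polynomial.map_add, hbc, Polynomial.map_ofNat, map_ofNat]
    have ha : series (-1 : K[X]) = -1 := by
      change param ((-1 : K[X]).map i) = -1
      rw [Polynomial.map_neg, Polynomial.map_one, map_neg, map_one]
    rw [ha, fiberPoly_neg_one hbc']
    refine ⟨(Splits.X_sub_C _).pow _, K', hK', fun r hr => ?_, fun h => ?_⟩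
    · have : r = -1 := by
        rw [roots_pow, roots_X_sub_C] at hr
        simpa using Multiset.mem_of_mem_nsmul hr
      rw [this, ← ha]
      exact fixedBy_series _ _
    · exact absurd ⟨hN, rfl, hbc⟩ h
  · have hexc' : ¬ (2 ≤ N ∧ a.map i = -1 ∧ b.map i + c.map i = 2) := by
      rintro ⟨h1, h2, h3⟩
      have hinj := Polynomial.map_injective i i.injective
      refine hexc ⟨h1, hinj ?_, hinj ?_⟩
      · rw [h2]; simp
      · rw [Polynomial.map_add, h3, Polynomial.map_ofNat]
    rcases quadraticRoots_param hb' hc' N hexc' with h | ⟨w, hw0, hw, h⟩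
    · obtain ⟨K', hK'⟩ := hdefault
      obtain ⟨s, hs, hr⟩ := h.le_card
      exact ⟨h.splits, K', hK', fun r hr => fixedBy_of_mem_series (h.mem r hr), fun _ =>
        ⟨s, hr, .inr ⟨hs, fun r hrs => flip_eq_of_mem
          (h.mem r ((mem_roots hF.ne_zero).2 (hr r hrs)))⟩⟩⟩
    · obtain ⟨K', hK', hmem⟩ := exists_quadratic
        (sq_leadingCoeff_mem_range (fixedBy_of_mem_series hw))
      have hwK' : FixedBy K' w := fixedBy_of_sq hw0 (fixedBy_of_mem_series hw) hmem
      obtain ⟨s, hs, hr⟩ := h.exists_finset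
      refine ⟨h.splits, K', hK', fun r hr => fixedBy_of_mem ?_ (h.mem r hr), fun _ =>
        ⟨s, hr, .inl hs⟩⟩
      rintro s (rfl | rfl | rfl | rfl)
      exacts [fixedBy_series K' b, fixedBy_series K' c, fixedBy_series K' a, hwK']

/-- Counting along a relation whose fibres are contained in orbits `{ρ, τ ρ}`. -/
theorem card_le_of_flip_fibers {α β : Type*} {Z : Finset α} {T : Set β} (hT : T.Finite)
    {R : α → β → Prop} (τ : α → α) (h₁ : ∀ ρ ∈ Z, ∃ A ∈ T, R ρ A)
    (h₂ : ∀ ρ₁ ρ₂ A, R ρ₁ A → R ρ₂ A → ρ₂ = ρ₁ ∨ ρ₂ = τ ρ₁) :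
    Z.card ≤ 2 * T.ncard ∧ ((∀ ρ ∈ Z, τ ρ = ρ) → Z.card ≤ T.ncard) := by
  classical
  have h₁' : ∀ ρ : Z, ∃ A ∈ T, R ρ A := fun ρ => h₁ ρ ρ.2
  choose g hgT hgR using h₁'
  have hmaps : ∀ ρ ∈ Z.attach, g ρ ∈ hT.toFinset := fun ρ _ => hT.mem_toFinset.2 (hgT ρ)
  rw [Set.ncard_eq_toFinset_card T hT, ← Finset.card_attach]
  have hcard : ∀ n, (∀ ρ₁ : Z, ∃ t : Finset Z, t.card ≤ n ∧ ∀ ρ₂, g ρ₂ = g ρ₁ → ρ₂ ∈ t) →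
      Z.attach.card ≤ n * hT.toFinset.card := by
    intro n hn
    refine Finset.card_le_mul_card_image_of_maps_to hmaps n fun A _ => ?_
    rcases (Z.attach.filter fun ρ => g ρ = A).eq_empty_or_nonempty with he | ⟨ρ₁, hρ₁⟩
    · rw [he]; simp
    · obtain ⟨t, ht, hmem⟩ := hn ρ₁
      refine (Finset.card_le_card fun ρ₂ hρ₂ => hmem ρ₂ ?_).trans ht
      rw [(Finset.mem_filter.1 hρ₁).2, (Finset.mem_filter.1 hρ₂).2]
  refine ⟨hcard 2 fun ρ₁ => ?_, fun hτ => ?_⟩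
  · let t : Finset Z := Z.attach.filter fun ρ₂ : Z => (ρ₂ : α) = ρ₁ ∨ (ρ₂ : α) = τ ρ₁
    refine ⟨t, ?_, fun ρ₂ h => ?_⟩
    · calc t.card = (t.map (Function.Embedding.subtype _)).card := (Finset.card_map _).symm
        _ ≤ ({(ρ₁ : α), τ ρ₁} : Finset α).card := Finset.card_le_card fun x hx => by
            obtain ⟨y, hy, rfl⟩ := Finset.mem_map.1 hx
            simpa using (Finset.mem_filter.1 hy).2
        _ ≤ 2 := Finset.card_le_two
    · exact Finset.mem_filter.2 ⟨Finset.mem_attach _ _, h₂ ρ₁ ρ₂ (g ρ₁) (hgR ρ₁) (h ▸ hgR ρ₂)⟩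
  · have := hcard 1 fun ρ₁ => ⟨{ρ₁}, by simp, fun ρ₂ h => ?_⟩
    · rwa [one_mul] at this
    · rw [Finset.mem_singleton]
      apply Subtype.ext
      have := h₂ ρ₁ ρ₂ (g ρ₁) (hgR ρ₁) (h ▸ hgR ρ₂)
      rwa [hτ ρ₁ ρ₁.2, or_self] at this

namespace Component

theorem IsGenericRoot.exists_rational {L : Type*} [Field L] [Algebra L (AlgebraicClosure K)]
    {Y : Component a b c N} {ρ : LaurentSeries (AlgebraicClosure K)} (h : Y.IsGenericRoot ρ)
    (hL : FixedBy L ρ) : ∃ A ∈ Y.rationalPointsAtInfinity L, Y.Represents ρ A := by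
  obtain ⟨A, hA⟩ := h.exists_represents
  exact ⟨A, ⟨hA.mem_pointsAtInfinity, hA.isRational hL⟩, hA⟩

variable [CharZero K]

/-- Once the equation of `Y(N)` splits, a component has as many roots as its degree in `x`. -/
theorem exists_finset_isGenericRoot (hsplit : ((geomPoly a b c N).map param).Splits)
    (Y : Component a b c N) : ∃ Z : Finset (LaurentSeries (AlgebraicClosure K)),
      Z.card = Y.degX ∧ Z.Nonempty ∧
        ∀ ρ ∈ Z, Y.IsGenericRoot ρ ∧ ρ ∈ ((geomPoly a b c N).map param).roots := by
  classical
  obtain ⟨f, hm, hf, hY, hdvd, hdeg⟩ := Y.exists_monic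
  have hF0 : (geomPoly a b c N).map param ≠ 0 := ((geomPoly_monic a b c N).map _).ne_zero
  have hdvd' : f.map param ∣ (geomPoly a b c N).map param := Polynomial.map_dvd _ hdvd
  have hfs : (f.map param).Splits := hsplit.of_dvd hF0 hdvd'
  have hsep : (f.map param).Separable := separable_map_of_irreducible param_injective hf hm
  have hcard : (f.map param).roots.toFinset.card = Y.degX := by
    rw [Multiset.toFinset_card_of_nodup (nodup_roots hsep), ← hfs.natDegree_eq_card_roots,
      hm.natDegree_map, hdeg]
  refine ⟨(f.map param).roots.toFinset, hcard, ?_, fun ρ hρ => ?_⟩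
  · rw [← Finset.card_pos, hcard, hdeg, Nat.pos_iff_ne_zero, Ne, hm.natDegree_eq_zero]
    exact fun h => hf.not_isUnit (h ▸ isUnit_one)
  · rw [Multiset.mem_toFinset] at hρ
    refine ⟨isGenericRoot_of_eval hm hf hY ?_, Multiset.mem_of_le (roots.le_of_dvd hF0 hdvd') hρ⟩
    have := (mem_roots'.1 hρ).2
    rwa [IsRoot, eval_map] at this

theorem finite_rationalPointsAtInfinity (Y : Component a b c N) (L : Type*) [Field L]
    [Algebra L (AlgebraicClosure K)] : (Y.rationalPointsAtInfinity L).Finite :=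
  Y.finite_pointsAtInfinity_and_ncard_le.1.subset fun _ h => h.1

/-- If the roots are series in `t⁻¹`, there is a bijection between them and the points at
infinity. -/
theorem exists_represents_of_flip (hsplit : ((geomPoly a b c N).map param).Splits)
    (hflip : ∀ r ∈ ((geomPoly a b c N).map param).roots, flip r = r) (Y : Component a b c N) :
    Y.pointsAtInfinity.ncard = Y.degX ∧ ∀ A ∈ Y.pointsAtInfinity,
      ∃ ρ ∈ ((geomPoly a b c N).map param).roots, Y.Represents ρ A := by
  obtain ⟨Z, hcard, -, hZ⟩ := exists_finset_isGenericRoot hsplit Y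
  obtain ⟨hfin, hle⟩ := Y.finite_pointsAtInfinity_and_ncard_le
  set T := {A : ValuationSubring Y.FunctionField | ∃ ρ ∈ Z, Y.Represents ρ A}
  have hTsub : T ⊆ Y.pointsAtInfinity := by
    rintro A ⟨ρ, -, hA⟩
    exact hA.mem_pointsAtInfinity
  have hTcard : Z.card ≤ T.ncard := by
    refine (card_le_of_flip_fibers (hfin.subset hTsub) (R := fun ρ A => Y.Represents ρ A) flip
      (fun ρ hρ => ?_) fun ρ₁ ρ₂ A h₁ h₂ => h₁.eq_or_eq_flip h₂).2 fun ρ hρ => hflip ρ (hZ ρ hρ).2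
    obtain ⟨A, hA⟩ := (hZ ρ hρ).1.exists_represents
    exact ⟨A, ⟨ρ, hρ, hA⟩, hA⟩
  rw [hcard] at hTcard
  have hT := Set.eq_of_subset_of_ncard_le hTsub (hle.trans hTcard) hfin
  refine ⟨le_antisymm hle (hT ▸ hTcard), fun A hA => ?_⟩
  rw [← hT] at hA
  obtain ⟨ρ, hρ, hA⟩ := hA
  exact ⟨ρ, (hZ ρ hρ).2, hA⟩

end Component

variable [CharZero K]

theorem finite_component (hsplit : ((geomPoly a b c N).map param).Splits) :
    Finite (Component a b c N) := by
  classical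
  have h : ∀ Y : Component a b c N, ∃ ρ : ((geomPoly a b c N).map param).roots.toFinset,
      Y.IsGenericRoot ρ := fun Y => by
    obtain ⟨Z, -, ⟨ρ, hρ⟩, hZ⟩ := Component.exists_finset_isGenericRoot hsplit Y
    exact ⟨⟨ρ, Multiset.mem_toFinset.2 (hZ ρ hρ).2⟩, (hZ ρ hρ).1⟩
  choose r hr using h
  refine Finite.of_injective r fun Y Y' hY => (hr Y).ideal_eq (hY ▸ hr Y')

theorem finite_rationalPointsAtInfinity (hsplit : ((geomPoly a b c N).map param).Splits)
    (L : Type*) [Field L] [Algebra L (AlgebraicClosure K)] :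
    (rationalPointsAtInfinity a b c N L).Finite := by
  have := finite_component hsplit
  refine Set.Finite.subset (Set.finite_iUnion fun Y : Component a b c N =>
    (Y.finite_rationalPointsAtInfinity L).image (Sigma.mk Y)) ?_
  rintro ⟨Y, A⟩ h
  exact Set.mem_iUnion.2 ⟨Y, A, h, rfl⟩

theorem card_le_ncard_rationalPointsAtInfinity
    (hsplit : ((geomPoly a b c N).map param).Splits) (L : Type*) [Field L]
    [Algebra L (AlgebraicClosure K)] {Z : Finset (LaurentSeries (AlgebraicClosure K))}
    (hroot : ∀ r ∈ Z, ((geomPoly a b c N).map param).IsRoot r)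
    (hL : ∀ r ∈ Z, FixedBy L r) :
    Z.card ≤ 2 * (rationalPointsAtInfinity a b c N L).ncard ∧
      ((∀ r ∈ Z, flip r = r) → Z.card ≤ (rationalPointsAtInfinity a b c N L).ncard) := by
  refine card_le_of_flip_fibers (finite_rationalPointsAtInfinity hsplit L)
    (R := fun ρ p => p.1.Represents ρ p.2) flip (fun ρ hρ => ?_)
    fun ρ₁ ρ₂ p h₁ h₂ => h₁.eq_or_eq_flip h₂
  have hev : evalAt ρ (geomPoly a b c N) = 0 := by
    have := hroot ρ hρ
    rwa [IsRoot, eval_map] at this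
  obtain ⟨Y, hY⟩ := Component.exists_isGenericRoot hev
  obtain ⟨A, hA, hR⟩ := hY.exists_rational (hL ρ hρ)
  exact ⟨⟨Y, A⟩, hA, hR⟩

theorem ncard_rationalPointsAtInfinity_le (hsplit : ((geomPoly a b c N).map param).Splits)
    (hflip : ∀ r ∈ ((geomPoly a b c N).map param).roots, flip r = r) (L : Type*) [Field L]
    [Algebra L (AlgebraicClosure K)] : (rationalPointsAtInfinity a b c N L).ncard ≤ 2 ^ N := by
  classical
  have h : ∀ p ∈ rationalPointsAtInfinity a b c N L,
      ∃ ρ ∈ ((geomPoly a b c N).map param).roots, p.1.Represents ρ p.2 := fun p hp =>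
    (Component.exists_represents_of_flip hsplit hflip p.1).2 p.2 hp.1
  choose! r hr hR using h
  have hle : (rationalPointsAtInfinity a b c N L).ncard ≤
      (((geomPoly a b c N).map param).roots.toFinset :
        Set (LaurentSeries (AlgebraicClosure K))).ncard := by
    refine Set.ncard_le_ncard_of_injOn r (fun p hp => ?_) ?_ (Finset.finite_toSet _)
    · exact Finset.mem_coe.2 (Multiset.mem_toFinset.2 (hr p hp))
    · rintro ⟨Y, A⟩ hp ⟨Y', A'⟩ hp' heq
      have h₁ := hR _ hp
      have h₂ := hR _ hp'
      rw [← heq] at h₂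
      obtain rfl : Y = Y' := h₁.isGenericRoot.ideal_eq h₂.isGenericRoot
      exact congrArg (Sigma.mk Y) (h₁.unique h₂)
  rw [Set.ncard_coe_finset] at hle
  refine hle.trans ((Multiset.toFinset_card_le _).trans ((card_roots' _).trans ?_))
  rw [geomPoly_map_param, fiberPoly_natDegree]

end Count

end PreimageCurve

end

open PreimageCurve Component in
theorem theorem4p8 {K : Type*} [Field K] [NumberField K] (a b c : Polynomial K)
    (hb : 0 < b.natDegree) (hc : 0 < c.natDegree) (N : ℕ) (hN : 1 ≤ N)
    (Y : PreimageCurve.Component a b c N) :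
    (∃ K' : IntermediateField K (AlgebraicClosure K),
      Module.finrank K K' = 2 ∧
      Y.IsDefinedOver K' ∧
      (1 / 2 : ℝ) * (Y.degX : ℝ) ≤ ((Y.rationalPointsAtInfinity K').ncard : ℝ) ∧
      (¬ (2 ≤ N ∧ a = -1 ∧ b + c = 2) →
        2 ^ (N - 1) ≤ (PreimageCurve.rationalPointsAtInfinity a b c N K').ncard)) ∧
    (a.degree + c.degree ≠ b.degree →
      Y.IsDefinedOver K ∧
      (Y.rationalPointsAtInfinity K).ncard = Y.degX ∧
      (PreimageCurve.rationalPointsAtInfinity a b c N K).ncard = 2 ^ N) := by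
  classical
  obtain ⟨hsplit, K', hK', hfix, hcount⟩ := exists_quadratic_fixedBy (a := a) (N := N) hb hc
  have hF0 : (geomPoly a b c N).map param ≠ 0 := ((geomPoly_monic a b c N).map _).ne_zero
  obtain ⟨Z, hZcard, ⟨ρ₀, hρ₀⟩, hZ⟩ := exists_finset_isGenericRoot hsplit Y
  refine ⟨⟨K', hK', (hZ ρ₀ hρ₀).1.isDefinedOver (hfix _ (hZ ρ₀ hρ₀).2), ?_, fun hexc => ?_⟩,
    fun hdeg => ?_⟩
  · have := (card_le_of_flip_fibers (Y.finite_rationalPointsAtInfinity K')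
      (R := fun ρ A => Y.Represents ρ A) flip
      (fun ρ hρ => (hZ ρ hρ).1.exists_rational (hfix ρ (hZ ρ hρ).2))
      fun ρ₁ ρ₂ A h₁ h₂ => h₁.eq_or_eq_flip h₂).1
    rw [hZcard] at this
    have : (Y.degX : ℝ) ≤ 2 * ((Y.rationalPointsAtInfinity K').ncard : ℝ) := by exact_mod_cast this
    linarith
  · obtain ⟨s, hs, hcard⟩ := hcount hexc
    obtain ⟨h1, h2⟩ := card_le_ncard_rationalPointsAtInfinity hsplit K' hs
      fun r hr => hfix r ((mem_roots hF0).2 (hs r hr))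
    rcases hcard with h | ⟨h, hflip⟩
    · have h3 := h.trans h1
      obtain ⟨n, rfl⟩ : ∃ n, N = n + 1 := ⟨N - 1, by omega⟩
      rw [pow_succ] at h3
      rw [Nat.add_sub_cancel]
      omega
    · exact h.trans (h2 hflip)
  · have hS : SplitsOver (ordVal (AlgebraicClosure K)) {series b, series c, series a}
        ((geomPoly a b c N).map param) := by
      rw [geomPoly_map_param]
      refine splitsOver_of_degree_ne (by rwa [natDegree_map]) (by rwa [natDegree_map]) ?_ N
      rwa [degree_map, degree_map, degree_map]
    have hflip : ∀ r ∈ ((geomPoly a b c N).map param).roots, flip r = r :=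
      fun r hr => flip_eq_of_mem (hS.mem r hr)
    have hK : ∀ r ∈ ((geomPoly a b c N).map param).roots, FixedBy K r :=
      fun r hr => fixedBy_of_mem_series (hS.mem r hr)
    obtain ⟨hncard, hrep⟩ := exists_represents_of_flip hsplit hflip Y
    refine ⟨(hZ ρ₀ hρ₀).1.isDefinedOver (hK _ (hZ ρ₀ hρ₀).2), ?_,
      le_antisymm (ncard_rationalPointsAtInfinity_le hsplit hflip K) ?_⟩
    · have : Y.rationalPointsAtInfinity K = Y.pointsAtInfinity := by
        refine Set.Subset.antisymm (fun A hA => hA.1) fun A hA => ?_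
        obtain ⟨ρ, hρ, hR⟩ := hrep A hA
        exact ⟨hA, hR.isRational (hK ρ hρ)⟩
      rw [this, hncard]
    · have hcard : ((geomPoly a b c N).map param).roots.toFinset.card = 2 ^ N := by
        rw [geomPoly_map_param] at hS ⊢
        exact hS.card_roots
      rw [← hcard]
      exact (card_le_ncard_rationalPointsAtInfinity hsplit K
        (fun r hr => isRoot_of_mem_roots (Multiset.mem_toFinset.1 hr))
        fun r hr => hK r (Multiset.mem_toFinset.1 hr)).2
        fun r hr => hflip r (Multiset.mem_toFinset.1 hr)
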